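/- **Definitions.** Let $\Lambda$ be a Lie algebra of smooth vector fields on $\mathbb{R}^n$ (a real linear space of $C^\infty$ fields closed under $[X,Y]=\frac{\partial Y}{\partial x}X-\frac{\partial X}{\partial x}Y$) and $x_0\in\mathbb{R}^n$. An *orbit of the origin $x_0$* along fields $X_1,\dots,X_k$ is a map $$y(p)=G_1(t_1)\circ\cdots\circ G_k(t_k)(x_0),\qquad p=(t_1,\dots,t_k)\in D_k=\prod_{i=1}^k(-a_i,a_i),\ a_i>0,$$ where $G_i(t)(x)$, $t\in(-a_i,a_i)$, $x\in V$, is the local flow generated by $X_i$, $V$ is an open neighbourhood of $x_0$, and every point to which a flow is applied in this composition lies in $V$. Fields $Y_1,\dots,Y_M\in\Lambda$ form a *system of generators* (and $\Lambda$ is *finitely generated with respect to the orbits of the origin $x_0$*) if for every orbit $y$ of the origin $x_0$ along fields of $\Lambda$ and every $Y\in\Lambda$ there are $c_1,\dots,c_M\in C^\infty(D_k;\mathbb{R})$ with $Y(y(p))=\sum_{j=1}^M c_j(p)\,Y_j(y(p))$ for all $p\in D_k$. **Theorem.** Let $g_1,\dots,g_m\in C^\infty(\mathbb{R}^n;\mathbb{R}^n)$,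 let $L(g_1,\dots,g_m)$ be the smallest Lie algebra of smooth vector fields containing them, and assume that it is finitely generated with respect to the orbits of the origin $x_0$, with system of generators $Y_1,\dots,Y_M$. Let $y(p)=G_1(t_1)\circ\cdots\circ G_M(t_M)(x_0)$, $p=(t_1,\dots,t_M)\in D_M$, be an orbit along $Y_1,\dots,Y_M$. Put $H_i(t;y)=\big[\frac{\partial G_i}{\partial y}(t;y)\big]^{-1}$, $X_1=Y_1$ and, for $2\le j\le M$, $$X_j(t_1,\dots,t_{j-1};y)=H_1(-t_1;y_1)\cdots H_{j-1}(-t_{j-1};y_{j-1})\,Y_j(y_j),\qquad y_1=y,\quad y_{i+1}=G_i(-t_i)(y_i).$$ Then there are a ball $B(0,\alpha)\subseteq D_M$, $\alpha>0$, and a matrix function $A=(a_{ij})$ of size $M\times M$ with $a_{ij}\in C^\infty(B(0,\alpha))$, $A(p)$ nonsingular for every $p\in B(0,\alpha)$ and $A(0)=I_M$, such that for every $p\in B(0,\alpha)$ $$\{Y_1,X_2(t_1;\cdot),\dots,X_M(t_1,\dots,t_{M-1};\cdot)\}(y(p))=\{Y_1,\dots,Y_M\}(y(p))\,A(p).$$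 On $B(0,\alpha)$ the orbit solves the associated gradient system $\frac{\partial y}{\partial t_1}=Y_1(y)$, $\frac{\partial y}{\partial t_j}=X_j(t_1,\dots,t_{j-1};y)$ for $2\le j\le M$, with $y(0)=x_0$. Moreover, $A$ can be taken of the following form. With $y_j(p)=G_j(t_j)\circ\cdots\circ G_M(t_M)(x_0)$, there are smooth $M\times M$ matrices $B_j(t_j,\dots,t_M)$ on $B(0,\alpha)$ with $$\big\{[Y_j,Y_1],\dots,[Y_j,Y_M]\big\}(y_j(p))=\{Y_1,\dots,Y_M\}(y_j(p))\,B_j(t_j,\dots,t_M),$$ and the $j$-th column of $A(p)$ is the $j$-th column of $Z_1(t_1)Z_2(t_2)\cdots Z_{j-1}(t_{j-1})$, where, for given $p$, $Z_j$ is the solution between $0$ and $t_j$ of the linear matrix equation $$\frac{dZ_j}{ds}(s)=-Z_j(s)\,B_j(t_j-s,t_{j+1},\dots,t_M),\qquad Z_j(0)=I_M.$$ -/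

import Mathlib

open scoped ContDiff

/-- `ℝⁿ` with its Euclidean norm. -/
abbrev RVec (n : ℕ) : Type := EuclideanSpace ℝ (Fin n)

/-- A real linear space of smooth vector fields on `ℝⁿ` that is closed under the Lie bracket
`[X, Y](x) = DY(x) X(x) - DX(x) Y(x)`. -/
def IsLieAlgebraOfFields {n : ℕ} (L : Submodule ℝ (RVec n → RVec n)) : Prop :=
  (∀ X ∈ L, ContDiff ℝ ∞ X) ∧ ∀ X ∈ L, ∀ Y ∈ L, VectorField.lieBracket ℝ X Y ∈ L

/-- `L(g₁, …, g_m)`: the smallest Lie algebra of smooth vector fields containing the `gᵢ`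
(see `isLeast_generatedLieAlgebra`). -/
noncomputable def generatedLieAlgebra {n m : ℕ} (g : Fin m → RVec n → RVec n) :
    Submodule ℝ (RVec n → RVec n) :=
  sInf {L | IsLieAlgebraOfFields L ∧ ∀ i, g i ∈ L}

theorem isLeast_generatedLieAlgebra {n m : ℕ} (g : Fin m → RVec n → RVec n)
    (hg : ∀ i, ContDiff ℝ ∞ (g i)) :
    IsLeast {L : Submodule ℝ (RVec n → RVec n) | IsLieAlgebraOfFields L ∧ ∀ i, g i ∈ L}
      (generatedLieAlgebra g) := by
  let S : Submodule ℝ (RVec n → RVec n) :=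
    { carrier := {X | ContDiff ℝ ∞ X}
      add_mem' := fun {X Y} (hX : ContDiff ℝ ∞ X) (hY : ContDiff ℝ ∞ Y) => hX.add hY
      zero_mem' := (contDiff_const : ContDiff ℝ ∞ fun _ : RVec n => (0 : RVec n))
      smul_mem' := fun c X (hX : ContDiff ℝ ∞ X) => contDiff_const.smul hX }
  have hS : S ∈ {L : Submodule ℝ (RVec n → RVec n) | IsLieAlgebraOfFields L ∧ ∀ i, g i ∈ L} :=
    ⟨⟨fun _ hX => hX, fun X hX Y hY =>
      ContDiff.lieBracket_vectorField (m := ∞) (n := ∞) hX hY (by simp)⟩, hg⟩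
  refine ⟨⟨⟨fun X hX => sInf_le hS hX, fun X hX Y hY => ?_⟩, fun i => ?_⟩,
    fun L hL => sInf_le hL⟩
  · refine (Submodule.mem_sInf).2 fun L hL => ?_
    exact hL.1.2 X (sInf_le hL hX) Y (sInf_le hL hY)
  · exact (Submodule.mem_sInf).2 fun L hL => hL.2 i

/-- The open box `∏ᵢ (-aᵢ, aᵢ)`. -/
def openBox {k : ℕ} (a : Fin k → ℝ) : Set (Fin k → ℝ) :=
  Set.univ.pi fun i => Set.Ioo (-a i) (a i)

/-- `G t x`, for `t ∈ (-a, a)` and `x ∈ V`, is the local flow generated by the vector field `X`. -/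
structure IsLocalFlow {n : ℕ} (X : RVec n → RVec n) (a : ℝ) (V : Set (RVec n))
    (G : ℝ → RVec n → RVec n) : Prop where
  initial : ∀ x ∈ V, G 0 x = x
  hasDerivAt : ∀ x ∈ V, ∀ t ∈ Set.Ioo (-a) a, HasDerivAt (fun s => G s x) (X (G t x)) t

/-- Indices start at `0`; `orbitTail G x₀ p j = G_j(t_j) ∘ ⋯ ∘ G_{k-1}(t_{k-1}) (x₀)` for
`p = (t₀, …, t_{k-1})`, and it is `x₀` for `j = k`. -/
def orbitTail {n k : ℕ} (G : Fin k → ℝ → RVec n → RVec n) (x₀ : RVec n) (p : Fin k → ℝ) (j : ℕ) :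
    RVec n :=
  ((List.finRange k).drop j).foldr (fun i z => G i (p i) z) x₀

/-- The full composition `y(p)` of all `k` flows, applied to `x₀`. -/
def orbit {n k : ℕ} (G : Fin k → ℝ → RVec n → RVec n) (x₀ : RVec n) (p : Fin k → ℝ) : RVec n :=
  orbitTail G x₀ p 0

/-- `p ↦ orbit G x₀ p`, for `p` in the box `∏ᵢ (-aᵢ, aᵢ)`, is an orbit of the origin `x₀` along the
vector fields `X i`: each `G i` is the local flow of `X i` for times in `(-aᵢ, aᵢ)` on a common
open neighbourhood `V` of `x₀`, and the composition makes sense, that is, every point to which one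
of the flows is applied belongs to `V`. -/
structure IsOrbit {n k : ℕ} (X : Fin k → RVec n → RVec n) (x₀ : RVec n) (a : Fin k → ℝ)
    (V : Set (RVec n)) (G : Fin k → ℝ → RVec n → RVec n) : Prop where
  pos : ∀ i, 0 < a i
  isOpen : IsOpen V
  mem : x₀ ∈ V
  flow : ∀ i, IsLocalFlow (X i) (a i) V (G i)
  tail_mem : ∀ p ∈ openBox a, ∀ i : Fin k, orbitTail G x₀ p (i + 1) ∈ V

/-- `Y₁, …, Y_M` is a system of generators showing that `L` is finitely generated with respect to
the orbits of the origin `x₀`: along every orbit made of flows of fields of `L`, every field of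
`L` is a combination of the `Y_j` with coefficients that are smooth functions of the orbit
parameter. -/
def IsGeneratorSystem {n M : ℕ} (L : Submodule ℝ (RVec n → RVec n)) (x₀ : RVec n)
    (Y : Fin M → RVec n → RVec n) : Prop :=
  (∀ j, Y j ∈ L) ∧
  ∀ (k : ℕ) (X : Fin k → RVec n → RVec n) (a : Fin k → ℝ) (V : Set (RVec n))
    (G : Fin k → ℝ → RVec n → RVec n), (∀ i, X i ∈ L) → IsOrbit X x₀ a V G →
    ∀ W ∈ L, ∃ c : Fin M → (Fin k → ℝ) → ℝ, (∀ j, ContDiffOn ℝ ∞ (c j) (openBox a)) ∧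
      ∀ p ∈ openBox a, W (orbit G x₀ p) = ∑ j, c j p • Y j (orbit G x₀ p)

/-- `pullBack G p W [i₁, …, i_r] y = H_{i₁}(-t_{i₁}; y₁) ⋯ H_{i_r}(-t_{i_r}; y_r) W(y_{r+1})`, where
`H_i(t; z) = [∂G_i/∂z (t; z)]⁻¹`, `y₁ = y` and `y_{s+1} = G_{i_s}(-t_{i_s}; y_s)`. -/
noncomputable def pullBack {n k : ℕ} (G : Fin k → ℝ → RVec n → RVec n) (p : Fin k → ℝ)
    (W : RVec n → RVec n) : List (Fin k) → RVec n → RVec n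
  | [], y => W y
  | i :: l, y => (fderiv ℝ (G i (-p i)) y).inverse (pullBack G p W l (G i (-p i) y))

/-- The field `X_j(t₀, …, t_{j-1}; y) = H₀(-t₀; y₀) ⋯ H_{j-1}(-t_{j-1}; y_{j-1}) Y_j(y_j)` of the
gradient system (indices from `0`); the first one is `Y₀` itself. -/
noncomputable def gradientField {n M : ℕ} (Y : Fin M → RVec n → RVec n)
    (G : Fin M → ℝ → RVec n → RVec n) (j : Fin M) (p : Fin M → ℝ) (y : RVec n) : RVec n :=
  pullBack G p (Y j) ((List.finRange M).take j) y

/-- The ordered product `W₀ W₁ ⋯ W_{j-1}` of square matrices. -/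
def orderedProd {M : ℕ} (W : Fin M → Matrix (Fin M) (Fin M) ℝ) (j : ℕ) :
    Matrix (Fin M) (Fin M) ℝ :=
  (((List.finRange M).take j).map W).prod

/-! By the chain rule, ∂y/∂t_j = DG_1(t_1)⋯DG_{j-1}(t_{j-1}) Y_j(y_j). Since G_i(-t_i) inverts
G_i(t_i), H_i(-t_i; y_i) is the Jacobian of G_i(t_i) at y_{i+1}, so the right-hand side is X_j(y):
the orbit solves the gradient system (`hasDerivAt_orbitTail`).

Along z(r) = G_i(r)(y_{i+1}), the vector DG_i(r)w solves u' = DY_i(z)u. A combination ∑ ν_k(r)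
Y_k(z(r)) solves the same equation when ν' = -B_i ν (`IsSmoothFlowOn.fderiv_apply_sum`). Hence
DG_i(t_i) acts on coefficients by the matrix N_i with ∂N_i/∂t_i = -B_i N_i and N_i = 1 at t_i = 0,
and column j of A is column j of N_1⋯N_{j-1} (`pullBack_eq_sum`). With K_i = N_i⁻¹, the matrix
Z_i(s) = N_i(p) K_i(p with t_i replaced by t_i - s) solves the required equation and ends at N_i(p).
As A(0) = I, continuity of the determinant makes A nonsingular on a small ball.

Two inputs remain. The B_i come from finite generation, applied to orbits whose first flows belong
to the zero field (`IsGeneratorSystem.exists_tail`). Joint smoothness of the given flows comes from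
the inverse function theorem in C([0,1], E) (`exists_contDiffOn_localFlow`); with the parameters
taken as part of the state, it also makes N_i smooth (`exists_smooth_solution`). -/

open Set Metric Filter Topology

universe u

/-! ### Smoothness of the superposition operator η ↦ f ∘ η -/

section Superposition

variable {K : Type*} [TopologicalSpace K] [CompactSpace K]
  {E F : Type u} [NormedAddCommGroup E] [NormedSpace ℝ E] [NormedAddCommGroup F] [NormedSpace ℝ F]

/-- A continuous family of operators acts pointwise on continuous functions. -/
noncomputable def pointwiseApply (K : Type*) [TopologicalSpace K] [CompactSpace K] (E F : Type u)
    [NormedAddCommGroup E] [NormedSpace ℝ E] [NormedAddCommGroup F] [NormedSpace ℝ F] :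
    C(K, E →L[ℝ] F) →L[ℝ] C(K, E) →L[ℝ] C(K, F) :=
  LinearMap.mkContinuous₂
    (LinearMap.mk₂ ℝ (fun (A : C(K, E →L[ℝ] F)) (h : C(K, E)) =>
        (⟨fun k => A k (h k), by fun_prop⟩ : C(K, F)))
      (fun A B h => by ext k; simp) (fun c A h => by ext k; simp)
      (fun A g h => by ext k; simp) (fun c A h => by ext k; simp)) 1
    (fun A h => by
      rw [one_mul]
      refine (ContinuousMap.norm_le _ (by positivity)).2 fun k => ?_
      exact ((A k).le_opNorm (h k)).trans
        (mul_le_mul (A.norm_coe_le_norm k) (h.norm_coe_le_norm k) (norm_nonneg _) (norm_nonneg A)))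

/-- The derivative of `f` is uniformly continuous near the compact range of `γ`, so the mean value
inequality bounds the remainder by ε‖η - γ‖ uniformly in `k`. -/
theorem hasFDerivAt_continuousMap_comp (f : C(E, F)) (hf : Differentiable ℝ f)
    (f' : C(E, E →L[ℝ] F)) (hf' : ∀ x, fderiv ℝ f x = f' x) (γ : C(K, E)) :
    HasFDerivAt (fun η : C(K, E) => f.comp η) (pointwiseApply K E F (f'.comp γ)) γ := by
  rw [hasFDerivAt_iff_isLittleO, Asymptotics.isLittleO_iff]
  intro ε hε
  have hcomp : IsCompact (range γ) := isCompact_range γ.continuous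
  have hu := hcomp.uniformContinuousAt_of_continuousAt f' (fun a _ => f'.continuous.continuousAt)
    (Metric.dist_mem_uniformity hε)
  obtain ⟨δ, hδ, hδ'⟩ := Metric.mem_uniformity_dist.1 hu
  filter_upwards [Metric.ball_mem_nhds γ hδ] with η hη
  refine (ContinuousMap.norm_le _ (by positivity)).2 fun k => ?_
  have hk : dist (η k) (γ k) < δ := (ContinuousMap.dist_apply_le_dist k).trans_lt hη
  have hmv := (convex_ball (γ k) δ).norm_image_sub_le_of_norm_fderiv_le' (𝕜 := ℝ) (f := f)
    (C := ε) (φ := f' (γ k)) (x := γ k) (y := η k) (fun x _ => hf x)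
    (fun x hx => by
      rw [hf', ← dist_eq_norm, dist_comm]
      exact (hδ' (a := γ k) (b := x) (by rw [dist_comm]; exact hx) (mem_range_self k)).le)
    (mem_ball_self hδ) hk
  refine hmv.trans ?_
  gcongr
  exact (η - γ).norm_coe_le_norm k

/-- The induction varies `F`: the derivative is again a superposition operator, by `fderiv ℝ f`,
with values in `E →L[ℝ] F`. This is why `E` and `F` share a universe. -/
theorem contDiff_nat_continuousMap_comp (r : ℕ) : ∀ {F : Type u} [NormedAddCommGroup F]
    [NormedSpace ℝ F] (f : C(E, F)), ContDiff ℝ r f →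
      ContDiff ℝ r fun η : C(K, E) => f.comp η := by
  induction r with
  | zero =>
    intro F _ _ f _
    simpa using f.continuous_postcomp
  | succ r ih =>
    intro F _ _ f hf
    push_cast at hf ⊢
    obtain ⟨hd, -, hc⟩ := contDiff_succ_iff_fderiv.1 hf
    refine contDiff_succ_iff_hasFDerivAt.2
      ⟨fun γ => pointwiseApply K E F ((⟨fderiv ℝ f, hc.continuous⟩ : C(E, E →L[ℝ] F)).comp γ),
        ?_, fun γ => hasFDerivAt_continuousMap_comp f hd _ (fun _ => rfl) γ⟩
    exact (pointwiseApply K E F).contDiff.comp (ih ⟨fderiv ℝ f, hc.continuous⟩ hc)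

theorem contDiff_continuousMap_comp (f : C(E, F)) (hf : ContDiff ℝ ∞ f) :
    ContDiff ℝ ∞ fun η : C(K, E) => f.comp η :=
  contDiff_infty.2 fun r => contDiff_nat_continuousMap_comp r f (contDiff_infty.1 hf r)

end Superposition

/-! ### The integration operator on C([0,1], E) -/

section Volterra

theorem continuous_extend_unitInterval {X : Type*} [TopologicalSpace X] (g : C(unitInterval, X)) :
    Continuous fun s : ℝ => g (projIcc 0 1 zero_le_one s) :=
  g.continuous.comp continuous_projIcc

variable {E : Type u} [NormedAddCommGroup E] [NormedSpace ℝ E]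

/-- The operator `g ↦ (τ ↦ ∫ s in 0..τ, g s)` on `C([0, 1], E)`. -/
noncomputable def volterra (E : Type u) [NormedAddCommGroup E] [NormedSpace ℝ E] :
    C(unitInterval, E) →L[ℝ] C(unitInterval, E) :=
  LinearMap.mkContinuous
    { toFun := fun g => ⟨fun τ => ∫ s in (0 : ℝ)..τ, g (projIcc 0 1 zero_le_one s),
        (intervalIntegral.continuous_primitive
          (fun a b => (continuous_extend_unitInterval g).intervalIntegrable a b) 0).comp
            continuous_subtype_val⟩
      map_add' := fun g h => by
        ext τ
        exact intervalIntegral.integral_add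
          ((continuous_extend_unitInterval g).intervalIntegrable _ _)
          ((continuous_extend_unitInterval h).intervalIntegrable _ _)
      map_smul' := fun c g => by
        ext τ
        exact intervalIntegral.integral_smul c _ } 1
    (fun g => by
      rw [one_mul]
      refine (ContinuousMap.norm_le _ (by positivity)).2 fun τ => ?_
      refine (intervalIntegral.norm_integral_le_of_norm_le_const (C := ‖g‖)
        fun s _ => g.norm_coe_le_norm _).trans ?_
      rw [sub_zero, abs_of_nonneg τ.2.1]
      exact mul_le_of_le_one_right (norm_nonneg _) τ.2.2)

theorem volterra_apply (g : C(unitInterval, E)) (τ : unitInterval) :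
    volterra E g τ = ∫ s in (0 : ℝ)..τ, g (projIcc 0 1 zero_le_one s) := rfl

end Volterra

/-! ### Uniqueness for differential equations on [0,1] -/

section Uniqueness

variable {E : Type u} [NormedAddCommGroup E] [NormedSpace ℝ E]

theorem eqOn_unitInterval_of_hasDerivAt [FiniteDimensional ℝ E] {f : E → E}
    (hf : ContDiff ℝ 1 f) {c : ℝ} {u v : ℝ → E}
    (hu : ∀ τ ∈ Icc (0 : ℝ) 1, HasDerivAt u (c • f (u τ)) τ)
    (hv : ∀ τ ∈ Icc (0 : ℝ) 1, HasDerivAt v (c • f (v τ)) τ) (h0 : u 0 = v 0) :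
    EqOn u v (Icc 0 1) := by
  have cu : ContinuousOn u (Icc 0 1) := fun τ hτ => (hu τ hτ).continuousAt.continuousWithinAt
  have cv : ContinuousOn v (Icc 0 1) := fun τ hτ => (hv τ hτ).continuousAt.continuousWithinAt
  obtain ⟨Cu, hCu⟩ := isCompact_Icc.exists_bound_of_continuousOn cu
  obtain ⟨Cv, hCv⟩ := isCompact_Icc.exists_bound_of_continuousOn cv
  have := FiniteDimensional.proper ℝ E
  -- Only local Lipschitz bounds are available, but both curves stay in one closed ball, which is
  -- compact and convex.
  obtain ⟨L, hL⟩ := (contDiff_const.smul hf : ContDiff ℝ 1 fun x => c • f x).contDiffOn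
    (s := closedBall (0 : E) (max Cu Cv)) |>.exists_lipschitzOnWith one_ne_zero
      (convex_closedBall _ _) (isCompact_closedBall _ _)
  refine ODE_solution_unique_of_mem_Icc_right (v := fun _ x => c • f x)
    (s := fun _ => closedBall (0 : E) (max Cu Cv)) (K := L) (fun _ _ => hL) cu
    (fun τ hτ => (hu τ (Ico_subset_Icc_self hτ)).hasDerivWithinAt) (fun τ hτ => ?_) cv
    (fun τ hτ => (hv τ (Ico_subset_Icc_self hτ)).hasDerivWithinAt) (fun τ hτ => ?_) h0
  · simpa using Or.inl (hCu τ (Ico_subset_Icc_self hτ))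
  · simpa using Or.inr (hCv τ (Ico_subset_Icc_self hτ))

theorem eqOn_unitInterval_of_linear {L : ℝ → E →L[ℝ] E} (hL : ContinuousOn L (Icc 0 1))
    {u v : ℝ → E} (hu : ∀ τ ∈ Icc (0 : ℝ) 1, HasDerivAt u (L τ (u τ)) τ)
    (hv : ∀ τ ∈ Icc (0 : ℝ) 1, HasDerivAt v (L τ (v τ)) τ) (h0 : u 0 = v 0) :
    EqOn u v (Icc 0 1) := by
  obtain ⟨C, hC⟩ := isCompact_Icc.exists_bound_of_continuousOn hL
  refine ODE_solution_unique_of_mem_Icc_right (v := fun τ x => L τ x)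
    (s := fun _ => univ) (K := C.toNNReal) (fun τ hτ => ?_)
    (fun τ hτ => (hu τ hτ).continuousAt.continuousWithinAt)
    (fun τ hτ => (hu τ (Ico_subset_Icc_self hτ)).hasDerivWithinAt) (fun τ hτ => mem_univ _)
    (fun τ hτ => (hv τ hτ).continuousAt.continuousWithinAt)
    (fun τ hτ => (hv τ (Ico_subset_Icc_self hτ)).hasDerivWithinAt) (fun τ hτ => mem_univ _) h0
  refine ((L τ).lipschitz.weaken ?_).lipschitzOnWith
  rw [← NNReal.coe_le_coe, coe_nnnorm]
  exact (hC τ (Ico_subset_Icc_self hτ)).trans (Real.le_coe_toNNReal C)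

end Uniqueness

/-! ### Joint smoothness of local flows -/

section Flow

variable {E : Type u} [NormedAddCommGroup E] [NormedSpace ℝ E]

/-- `(t, x, γ) ↦ (t, x, γ - x - t ∫ f ∘ γ)`; the zeros of the last component are the integral
curves of `t • f` that start at `x`. -/
noncomputable def picardMap (f : C(E, E)) (q : ℝ × E × C(unitInterval, E)) :
    ℝ × E × C(unitInterval, E) :=
  (q.1, q.2.1, q.2.2 - ContinuousLinearMap.const ℝ unitInterval q.2.1 -
    q.1 • volterra E (f.comp q.2.2))

theorem contDiff_picardMap (f : C(E, E)) (hf : ContDiff ℝ ∞ f) : ContDiff ℝ ∞ (picardMap f) := by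
  have h1 : ContDiff ℝ ∞ fun q : ℝ × E × C(unitInterval, E) => f.comp q.2.2 :=
    (contDiff_continuousMap_comp f hf).comp contDiff_snd.snd
  have h2 : ContDiff ℝ ∞ fun q : ℝ × E × C(unitInterval, E) =>
      ContinuousLinearMap.const ℝ unitInterval q.2.1 :=
    (ContinuousLinearMap.contDiff _).comp contDiff_snd.fst
  exact contDiff_fst.prodMk (contDiff_snd.fst.prodMk ((contDiff_snd.snd.sub h2).sub
    (contDiff_fst.smul ((volterra E).contDiff.comp h1))))

/-- The derivative of `picardMap f` at a point with `t = 0`; here `b = ∫ f ∘ γ`. -/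
noncomputable def picardDeriv (b : C(unitInterval, E)) :
    (ℝ × E × C(unitInterval, E)) ≃L[ℝ] (ℝ × E × C(unitInterval, E)) :=
  ContinuousLinearEquiv.equivOfInverse
    ((ContinuousLinearMap.fst ℝ ℝ (E × C(unitInterval, E))).prod
      (((ContinuousLinearMap.fst ℝ E C(unitInterval, E)).comp
          (ContinuousLinearMap.snd ℝ ℝ (E × C(unitInterval, E)))).prod
        ((ContinuousLinearMap.snd ℝ E C(unitInterval, E)).comp
            (ContinuousLinearMap.snd ℝ ℝ (E × C(unitInterval, E))) -
          (ContinuousLinearMap.const ℝ unitInterval).comp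
            ((ContinuousLinearMap.fst ℝ E C(unitInterval, E)).comp
              (ContinuousLinearMap.snd ℝ ℝ (E × C(unitInterval, E)))) -
          (ContinuousLinearMap.fst ℝ ℝ (E × C(unitInterval, E))).smulRight b)))
    ((ContinuousLinearMap.fst ℝ ℝ (E × C(unitInterval, E))).prod
      (((ContinuousLinearMap.fst ℝ E C(unitInterval, E)).comp
          (ContinuousLinearMap.snd ℝ ℝ (E × C(unitInterval, E)))).prod
        ((ContinuousLinearMap.snd ℝ E C(unitInterval, E)).comp
            (ContinuousLinearMap.snd ℝ ℝ (E × C(unitInterval, E))) +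
          (ContinuousLinearMap.const ℝ unitInterval).comp
            ((ContinuousLinearMap.fst ℝ E C(unitInterval, E)).comp
              (ContinuousLinearMap.snd ℝ ℝ (E × C(unitInterval, E)))) +
          (ContinuousLinearMap.fst ℝ ℝ (E × C(unitInterval, E))).smulRight b)))
    (fun q => by
      refine Prod.ext rfl (Prod.ext rfl ?_)
      simp only [ContinuousLinearMap.prod_apply, add_apply,
        sub_apply, ContinuousLinearMap.comp_apply,
        ContinuousLinearMap.coe_fst', ContinuousLinearMap.coe_snd',
        ContinuousLinearMap.smulRight_apply]
      abel)
    (fun q => by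
      refine Prod.ext rfl (Prod.ext rfl ?_)
      simp only [ContinuousLinearMap.prod_apply, add_apply,
        sub_apply, ContinuousLinearMap.comp_apply,
        ContinuousLinearMap.coe_fst', ContinuousLinearMap.coe_snd',
        ContinuousLinearMap.smulRight_apply]
      abel)

/-- At t = 0 the γ-derivative of t ∫ f ∘ γ vanishes. What remains is unipotent triangular, hence
invertible. -/
theorem hasFDerivAt_picardMap (f : C(E, E)) (hf : ContDiff ℝ ∞ f) (x : E)
    (γ : C(unitInterval, E)) :
    HasFDerivAt (picardMap f)
      (picardDeriv (volterra E (f.comp γ)) : _ →L[ℝ] ℝ × E × C(unitInterval, E)) (0, x, γ) := by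
  have h1 : DifferentiableAt ℝ (fun q : ℝ × E × C(unitInterval, E) => volterra E (f.comp q.2.2))
      (0, x, γ) :=
    ((volterra E).contDiff.comp ((contDiff_continuousMap_comp f hf).comp
      contDiff_snd.snd)).differentiable (by simp) _
  have hfst : HasFDerivAt (fun q : ℝ × E × C(unitInterval, E) => q.1)
      (ContinuousLinearMap.fst ℝ ℝ (E × C(unitInterval, E))) (0, x, γ) := hasFDerivAt_fst
  have h := hfst.prodMk (hasFDerivAt_snd.fst.prodMk ((hasFDerivAt_snd.snd.sub
    ((ContinuousLinearMap.const ℝ unitInterval).hasFDerivAt.comp _ hasFDerivAt_snd.fst)).sub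
    (hfst.smul h1.hasFDerivAt)))
  refine h.congr_fderiv ?_
  refine ContinuousLinearMap.ext fun q => ?_
  refine Prod.ext rfl (Prod.ext rfl ?_)
  simp [picardDeriv]

/-- A local flow of a smooth vector field is jointly smooth near `(0, x₀)`. -/
theorem exists_contDiffOn_localFlow [FiniteDimensional ℝ E] {f : E → E} (hf : ContDiff ℝ ∞ f)
    {a : ℝ} (ha : 0 < a) {V : Set E} (hV : IsOpen V) {x₀ : E} (hx₀ : x₀ ∈ V) {G : ℝ → E → E}
    (h0 : ∀ x ∈ V, G 0 x = x)
    (hG : ∀ x ∈ V, ∀ t ∈ Ioo (-a) a, HasDerivAt (fun s => G s x) (f (G t x)) t) :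
    ∃ ε > 0, ε ≤ a ∧ ball x₀ ε ⊆ V ∧
      ContDiffOn ℝ ∞ (fun q : ℝ × E => G q.1 q.2) (ball 0 ε ×ˢ ball x₀ ε) := by
  have : CompleteSpace E := FiniteDimensional.complete ℝ E
  let fc : C(E, E) := ⟨f, hf.continuous⟩
  have hfc : ContDiff ℝ ∞ fc := hf
  let Φ := picardMap fc
  let P₀ : ℝ × E × C(unitInterval, E) := (0, x₀, ContinuousLinearMap.const ℝ unitInterval x₀)
  have hΦ : ContDiff ℝ ∞ Φ := contDiff_picardMap fc hfc
  have hD := hasFDerivAt_picardMap fc hfc x₀ (ContinuousLinearMap.const ℝ unitInterval x₀)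
  let e := hΦ.contDiffAt.toOpenPartialHomeomorph Φ (a := P₀) hD (by simp)
  have he : ∀ q, e q = Φ q := fun q => rfl
  have hP₀ : P₀ ∈ e.source := hΦ.contDiffAt.mem_toOpenPartialHomeomorph_source hD (by simp)
  have hΦP₀ : Φ P₀ = (0, x₀, 0) := by
    refine Prod.ext rfl (Prod.ext rfl ?_)
    simp [Φ, P₀, picardMap]
  have htar : ((0 : ℝ), x₀, (0 : C(unitInterval, E))) ∈ e.target := by
    rw [← hΦP₀, ← he]; exact e.map_source hP₀
  have hsymm : e.symm (0, x₀, 0) = P₀ := by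
    rw [← hΦP₀, ← he]; exact e.left_inv hP₀
  have hcont : ContinuousAt e.symm (0, x₀, 0) := e.continuousAt_symm htar
  let ι : ℝ × E → ℝ × E × C(unitInterval, E) := fun q => (q.1, q.2, 0)
  have hι : ContDiff ℝ ∞ ι := contDiff_fst.prodMk (contDiff_snd.prodMk contDiff_const)
  -- Smoothness of the local inverse at a point needs an invertible derivative at its preimage.
  -- Invertible operators form an open set, so this persists near the base point.
  have hgood : ∀ᶠ q in 𝓝 ((0 : ℝ), x₀, (0 : C(unitInterval, E))), q ∈ e.target ∧
      fderiv ℝ Φ (e.symm q) ∈ range ContinuousLinearEquiv.toContinuousLinearMap := by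
    refine Filter.Eventually.and (e.open_target.mem_nhds htar) ?_
    have hc : ContinuousAt (fun q => fderiv ℝ Φ (e.symm q)) (0, x₀, 0) :=
      ContinuousAt.comp (hΦ.continuous_fderiv (by simp)).continuousAt hcont
    refine hc (ContinuousLinearEquiv.isOpen.mem_nhds ?_)
    change fderiv ℝ Φ (e.symm (0, x₀, 0)) ∈ _
    rw [hsymm, hD.fderiv]
    exact mem_range_self _
  have hgood' : ∀ᶠ q : ℝ × E in 𝓝 (0, x₀), ι q ∈ e.target ∧
      fderiv ℝ Φ (e.symm (ι q)) ∈ range ContinuousLinearEquiv.toContinuousLinearMap :=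
    (hι.continuous.tendsto (0, x₀)).eventually hgood
  have hV' : ∀ᶠ q : ℝ × E in 𝓝 (0, x₀), q.2 ∈ V ∧ q.1 ∈ Ioo (-a) a :=
    (continuous_snd.continuousAt.eventually (hV.mem_nhds hx₀)).and
      (continuous_fst.continuousAt.eventually (Ioo_mem_nhds (neg_neg_of_pos ha) ha))
  obtain ⟨ε₀, hε₀, hball⟩ := Metric.eventually_nhds_iff_ball.1 (hgood'.and hV')
  refine ⟨min ε₀ a, lt_min hε₀ ha, min_le_right _ _, fun x hx => ?_, ?_⟩
  · exact (hball (0, x) (by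
      rw [← ball_prod_same]
      exact ⟨mem_ball_self hε₀, ball_subset_ball (min_le_left _ _) hx⟩)).2.1
  have hsub : ball (0 : ℝ) (min ε₀ a) ×ˢ ball x₀ (min ε₀ a) ⊆ ball ((0 : ℝ), x₀) ε₀ := by
    rw [← ball_prod_same]
    exact prod_mono (ball_subset_ball (min_le_left _ _)) (ball_subset_ball (min_le_left _ _))
  -- The candidate flow: solve the Picard equation for the curve and evaluate it at rescaled time 1.
  -- Uniqueness will identify it with `G`.
  have hsmooth : ContDiffOn ℝ ∞ (fun q : ℝ × E => (e.symm (ι q)).2.2 1)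
      (ball 0 (min ε₀ a) ×ˢ ball x₀ (min ε₀ a)) := by
    intro q hq
    obtain ⟨⟨ht, A, hA⟩, -⟩ := hball q (hsub hq)
    have hs : ContDiffAt ℝ ∞ e.symm (ι q) := by
      refine e.contDiffAt_symm (f₀' := A) ht ?_ hΦ.contDiffAt
      change HasFDerivAt e A.toContinuousLinearMap _
      rw [hA]
      exact (hΦ.differentiable (by simp) _).hasFDerivAt
    exact ((ContinuousMap.evalCLM ℝ (1 : unitInterval)).contDiff.contDiffAt.comp q
      ((contDiff_snd.snd.contDiffAt).comp q (hs.comp q hι.contDiffAt))).contDiffWithinAt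
  refine hsmooth.congr fun q hq => ?_
  obtain ⟨⟨ht, -⟩, hqV, hqt⟩ := hball q (hsub hq)
  obtain ⟨t, x⟩ := q
  set γ := (e.symm (ι (t, x))).2.2 with hγ
  have hfix : Φ (e.symm (ι (t, x))) = (t, x, 0) := e.right_inv ht
  have hfix1 : (e.symm (ι (t, x))).1 = t := congrArg (·.1) hfix
  have hfix2 : (e.symm (ι (t, x))).2.1 = x := congrArg (·.2.1) hfix
  have hfix3 : γ - ContinuousLinearMap.const ℝ unitInterval x - t • volterra E (fc.comp γ) = 0 := by
    have := congrArg (·.2.2) hfix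
    simpa only [Φ, picardMap, hfix1, hfix2] using this
  have hγeq : ∀ τ : unitInterval, γ τ = x + t • ∫ s in (0 : ℝ)..τ,
      f (γ (projIcc 0 1 zero_le_one s)) := by
    intro τ
    have := congrArg (fun g : C(unitInterval, E) => g τ) hfix3
    simp only [ContinuousMap.sub_apply, ContinuousMap.smul_apply, ContinuousMap.zero_apply,
      volterra_apply] at this
    rw [sub_sub, sub_eq_zero] at this
    exact this
  -- The integral formula extends the curve to all of ℝ, which gives two-sided derivatives at the
  -- ends of [0,1] too.
  let w : ℝ → E := fun τ => x + t • ∫ s in (0 : ℝ)..τ, f (γ (projIcc 0 1 zero_le_one s))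
  have hcw : Continuous fun s : ℝ => f (γ (projIcc 0 1 zero_le_one s)) :=
    hf.continuous.comp (continuous_extend_unitInterval γ)
  have hw : ∀ τ ∈ Icc (0 : ℝ) 1, HasDerivAt w (t • f (w τ)) τ := by
    intro τ hτ
    have h1 := ((hcw.integral_hasStrictDerivAt 0 τ).hasDerivAt.const_smul t).const_add x
    have h2 : w τ = γ ⟨τ, hτ⟩ := (hγeq ⟨τ, hτ⟩).symm
    rw [h2]
    rwa [projIcc_of_mem zero_le_one hτ] at h1
  have hu : ∀ τ ∈ Icc (0 : ℝ) 1, HasDerivAt (fun τ => G (t * τ) x) (t • f (G (t * τ) x)) τ := by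
    intro τ hτ
    have hmem : t * τ ∈ Ioo (-a) a := by
      rw [mem_Ioo, ← abs_lt] at hqt ⊢
      rw [abs_mul, abs_of_nonneg hτ.1]
      exact (mul_le_of_le_one_right (abs_nonneg _) hτ.2).trans_lt hqt
    have h1 : HasDerivAt (fun s => t * s) t τ := by simpa using (hasDerivAt_id τ).const_mul t
    exact (hG x hqV _ hmem).scomp τ h1
  have := eqOn_unitInterval_of_hasDerivAt (hf.of_le (by simp)) hu hw
    (by simp [w, h0 x hqV]) (right_mem_Icc.2 zero_le_one)
  simp only [mul_one] at this
  change G t x = γ 1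
  rw [this, hγeq]
  rfl

end Flow

/-! ### Inverse flow, variational equation and transport of combinations -/

section SmoothFlow

variable {E : Type u} [NormedAddCommGroup E] [NormedSpace ℝ E]

/-- `G` is the flow of the smooth field `f`, and it is jointly smooth, for times in `(-ρ, ρ)` and
points of the ball of radius `ρ` around `x₀`. -/
structure IsSmoothFlowOn (f : E → E) (x₀ : E) (ρ : ℝ) (G : ℝ → E → E) : Prop where
  field : ContDiff ℝ ∞ f
  initial : ∀ x ∈ ball x₀ ρ, G 0 x = x
  hasDerivAt : ∀ x ∈ ball x₀ ρ, ∀ t ∈ ball (0 : ℝ) ρ, HasDerivAt (fun s => G s x) (f (G t x)) t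
  contDiffOn : ContDiffOn ℝ ∞ (fun q : ℝ × E => G q.1 q.2) (ball 0 ρ ×ˢ ball x₀ ρ)

namespace IsSmoothFlowOn

variable {f : E → E} {x₀ : E} {ρ : ℝ} {G : ℝ → E → E}

theorem mono (h : IsSmoothFlowOn f x₀ ρ G) {σ : ℝ} (hσ : σ ≤ ρ) : IsSmoothFlowOn f x₀ σ G where
  field := h.field
  initial x hx := h.initial x (ball_subset_ball hσ hx)
  hasDerivAt x hx t ht := h.hasDerivAt x (ball_subset_ball hσ hx) t (ball_subset_ball hσ ht)
  contDiffOn := h.contDiffOn.mono (prod_mono (ball_subset_ball hσ) (ball_subset_ball hσ))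

theorem contDiffAt (h : IsSmoothFlowOn f x₀ ρ G) {t : ℝ} (ht : t ∈ ball (0 : ℝ) ρ) {x : E}
    (hx : x ∈ ball x₀ ρ) : ContDiffAt ℝ ∞ (fun q : ℝ × E => G q.1 q.2) (t, x) :=
  h.contDiffOn.contDiffAt ((isOpen_ball.prod isOpen_ball).mem_nhds ⟨ht, hx⟩)

theorem differentiableAt (h : IsSmoothFlowOn f x₀ ρ G) {t : ℝ} (ht : t ∈ ball (0 : ℝ) ρ) {x : E}
    (hx : x ∈ ball x₀ ρ) : DifferentiableAt ℝ (G t) x :=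
  ((h.contDiffAt ht hx).differentiableAt (by simp)).comp (f := fun x : E => (t, x)) x
    ((differentiableAt_const t).prodMk differentiableAt_id)

theorem mul_mem {t τ : ℝ} (ht : t ∈ ball (0 : ℝ) ρ) (hτ : τ ∈ Icc (0 : ℝ) 1) :
    t * τ ∈ ball (0 : ℝ) ρ := by
  rw [mem_ball_zero_iff, Real.norm_eq_abs] at ht ⊢
  rw [abs_mul, abs_of_nonneg hτ.1]
  exact (mul_le_of_le_one_right (abs_nonneg _) hτ.2).trans_lt ht

theorem hasDerivAt_mul (h : IsSmoothFlowOn f x₀ ρ G) {t : ℝ} (ht : t ∈ ball (0 : ℝ) ρ) {x : E}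
    (hx : x ∈ ball x₀ ρ) {τ : ℝ} (hτ : τ ∈ Icc (0 : ℝ) 1) :
    HasDerivAt (fun τ => G (t * τ) x) (t • f (G (t * τ) x)) τ := by
  have h1 : HasDerivAt (fun s => t * s) t τ := by simpa using (hasDerivAt_id τ).const_mul t
  exact (h.hasDerivAt x hx _ (mul_mem ht hτ)).scomp τ h1

/-- Both τ ↦ G(-tτ)(G t x) and the reversed curve τ ↦ G(t(1-τ))x solve u' = -t f(u) from the same
point. -/
theorem neg_apply_apply [FiniteDimensional ℝ E] (h : IsSmoothFlowOn f x₀ ρ G) {t : ℝ}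
    (ht : t ∈ ball (0 : ℝ) ρ) {x : E} (hx : x ∈ ball x₀ ρ) (hy : G t x ∈ ball x₀ ρ) :
    G (-t) (G t x) = x := by
  have ht' : -t ∈ ball (0 : ℝ) ρ := by simpa using ht
  have hv : ∀ τ ∈ Icc (0 : ℝ) 1, HasDerivAt (fun τ => G (t * (1 - τ)) x)
      ((-t) • f (G (t * (1 - τ)) x)) τ := by
    intro τ hτ
    have hτ' : 1 - τ ∈ Icc (0 : ℝ) 1 := ⟨by linarith [hτ.2], by linarith [hτ.1]⟩
    have := (h.hasDerivAt_mul ht hx hτ').scomp τ ((hasDerivAt_id τ).const_sub 1)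
    simpa [Function.comp_def] using this
  have := eqOn_unitInterval_of_hasDerivAt (h.field.of_le (by simp))
    (fun τ hτ => h.hasDerivAt_mul ht' hy hτ) hv (by simp [h.initial _ hy])
    (right_mem_Icc.2 zero_le_one)
  simpa [h.initial _ hx] using this

theorem fderiv_neg_comp_fderiv [FiniteDimensional ℝ E] (h : IsSmoothFlowOn f x₀ ρ G) {t : ℝ}
    (ht : t ∈ ball (0 : ℝ) ρ) {x : E} (hx : x ∈ ball x₀ ρ) (hy : G t x ∈ ball x₀ ρ) :
    (fderiv ℝ (G (-t)) (G t x)).comp (fderiv ℝ (G t) x) = ContinuousLinearMap.id ℝ E := by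
  have ht' : -t ∈ ball (0 : ℝ) ρ := by simpa using ht
  have hd := h.differentiableAt ht hx
  have h1 := (h.differentiableAt ht' hy).hasFDerivAt.comp x hd.hasFDerivAt
  refine h1.unique ((hasFDerivAt_id x).congr_of_eventuallyEq ?_)
  filter_upwards [isOpen_ball.mem_nhds hx, hd.continuousAt (isOpen_ball.mem_nhds hy)] with z hz hz'
  exact h.neg_apply_apply ht hz hz'

theorem inverse_fderiv_neg [FiniteDimensional ℝ E] (h : IsSmoothFlowOn f x₀ ρ G) {t : ℝ}
    (ht : t ∈ ball (0 : ℝ) ρ) {x : E} (hx : x ∈ ball x₀ ρ) (hy : G t x ∈ ball x₀ ρ) :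
    (fderiv ℝ (G (-t)) (G t x)).inverse = fderiv ℝ (G t) x := by
  have ht' : -t ∈ ball (0 : ℝ) ρ := by simpa using ht
  have hb := h.neg_apply_apply ht hx hy
  refine ContinuousLinearMap.inverse_eq (h.fderiv_neg_comp_fderiv ht hx hy) ?_
  simpa [hb] using h.fderiv_neg_comp_fderiv ht' hy (by rwa [hb])

/-- Symmetry of the second derivative of the joint map allows exchanging ∂_t and ∂_x, and ∂_t G = f
∘ G. -/
theorem hasDerivAt_fderiv (h : IsSmoothFlowOn f x₀ ρ G) {t : ℝ} (ht : t ∈ ball (0 : ℝ) ρ) {x : E}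
    (hx : x ∈ ball x₀ ρ) (w : E) :
    HasDerivAt (fun r => fderiv ℝ (G r) x w) (fderiv ℝ f (G t x) (fderiv ℝ (G t) x w)) t := by
  set Φ : ℝ × E → E := fun q => G q.1 q.2 with hΦ
  have hd : ∀ r ∈ ball (0 : ℝ) ρ, ∀ y ∈ ball x₀ ρ, HasFDerivAt Φ (fderiv ℝ Φ (r, y)) (r, y) :=
    fun r hr y hy => ((h.contDiffAt hr hy).differentiableAt (by simp)).hasFDerivAt
  have hspace : ∀ r ∈ ball (0 : ℝ) ρ, ∀ y ∈ ball x₀ ρ,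
      fderiv ℝ (G r) y w = fderiv ℝ Φ (r, y) (0, w) := by
    intro r hr y hy
    have := (hd r hr y hy).comp (f := fun y : E => (r, y)) y (hasFDerivAt_prodMk_right r y)
    rw [show G r = Φ ∘ fun y => (r, y) from rfl, this.fderiv]
    simp
  have htime : ∀ r ∈ ball (0 : ℝ) ρ, ∀ y ∈ ball x₀ ρ, fderiv ℝ Φ (r, y) (1, 0) = f (G r y) := by
    intro r hr y hy
    have h1 := (hd r hr y hy).comp_hasDerivAt (f := fun r : ℝ => (r, y)) r
      ((hasDerivAt_id r).prodMk (hasDerivAt_const r y))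
    exact h1.unique (h.hasDerivAt y hy r hr)
  have h2 : HasFDerivAt (fderiv ℝ Φ) (fderiv ℝ (fderiv ℝ Φ) (t, x)) (t, x) :=
    (((h.contDiffAt ht hx).fderiv_right (m := ∞) (by simp)).differentiableAt
      (by simp)).hasFDerivAt
  have hsymm := (h.contDiffAt ht hx).isSymmSndFDerivAt (by
    rw [minSmoothness_of_isRCLikeNormedField]; exact WithTop.coe_le_coe.2 (le_top : (2 : ℕ∞) ≤ ⊤))
  have hL : HasDerivAt (fun r => fderiv ℝ (G r) x w)
      (fderiv ℝ (fderiv ℝ Φ) (t, x) (1, 0) (0, w)) t := by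
    have h1 := h2.comp_hasDerivAt (f := fun r : ℝ => (r, x)) t
      ((hasDerivAt_id t).prodMk (hasDerivAt_const t x))
    refine (h1.clm_apply (hasDerivAt_const t ((0 : ℝ), w))).congr_of_eventuallyEq ?_ |>.congr_deriv
      (by simp)
    filter_upwards [isOpen_ball.mem_nhds ht] with r hr
    exact hspace r hr x hx
  have hR : fderiv ℝ (fderiv ℝ Φ) (t, x) (0, w) (1, 0) =
      fderiv ℝ f (G t x) (fderiv ℝ (G t) x w) := by
    have hline : HasDerivAt (fun s : ℝ => x + s • w) w 0 := by
      simpa using ((hasDerivAt_id (0 : ℝ)).smul_const w).const_add x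
    have hx0 : x + (0 : ℝ) • w = x := by simp
    have h2' : HasFDerivAt (fderiv ℝ Φ) (fderiv ℝ (fderiv ℝ Φ) (t, x)) (t, x + (0 : ℝ) • w) := by
      rwa [hx0]
    have h1 := (h2'.comp_hasDerivAt (f := fun s : ℝ => (t, x + s • w)) 0
      ((hasDerivAt_const (0 : ℝ) t).prodMk hline)).clm_apply
        (hasDerivAt_const (0 : ℝ) ((1 : ℝ), (0 : E)))
    have h3 : HasFDerivAt (fun y => f (G t y)) ((fderiv ℝ f (G t x)).comp (fderiv ℝ (G t) x))
        (x + (0 : ℝ) • w) := by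
      rw [hx0]
      exact ((h.field.differentiable (by simp) _).hasFDerivAt).comp x
        (h.differentiableAt ht hx).hasFDerivAt
    have h4 := h3.comp_hasDerivAt (f := fun s : ℝ => x + s • w) 0 hline
    have h5 := h1.unique (h4.congr_of_eventuallyEq (by
      have : ∀ᶠ s : ℝ in 𝓝 0, x + s • w ∈ ball x₀ ρ :=
        hline.continuousAt (isOpen_ball.mem_nhds (by rwa [hx0]))
      filter_upwards [this] with s hs
      exact htime t ht _ hs))
    simpa using h5
  rw [← hR, ← hsymm.eq (1, 0) (0, w)]
  exact hL

/-- Let the brackets of `f` with the fields `Y k` be combinations of the `Y i` along an integral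
curve of `f`. The flow transports combinations of the `Y i` along that curve by a linear
differential equation for the coefficients. -/
theorem fderiv_apply_sum (h : IsSmoothFlowOn f x₀ ρ G) {ι : Type*} [Fintype ι] {Y : ι → E → E}
    (hY : ∀ i, Differentiable ℝ (Y i)) {t : ℝ} (ht : t ∈ ball (0 : ℝ) ρ) {x : E}
    (hx : x ∈ ball x₀ ρ) {b : ℝ → ι → ι → ℝ}
    (hb : ∀ r ∈ ball (0 : ℝ) ρ, |r| ≤ |t| → ∀ k, VectorField.lieBracket ℝ f (Y k) (G r x) =
      ∑ i, b r i k • Y i (G r x)) {ν : ℝ → ι → ℝ}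
    (hν : ∀ r ∈ ball (0 : ℝ) ρ, |r| ≤ |t| → ∀ i,
      HasDerivAt (fun r => ν r i) (-∑ k, b r i k * ν r k) r) :
    fderiv ℝ (G t) x (∑ i, ν 0 i • Y i x) = ∑ i, ν t i • Y i (G t x) := by
  set w := ∑ i, ν 0 i • Y i x
  have hρ : 0 < ρ := pos_of_mem_ball hx
  have hle : ∀ τ ∈ Icc (0 : ℝ) 1, |t * τ| ≤ |t| := fun τ hτ => by
    rw [abs_mul, abs_of_nonneg hτ.1]
    exact mul_le_of_le_one_right (abs_nonneg _) hτ.2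
  have hscale : ∀ τ : ℝ, HasDerivAt (fun s => t * s) t τ := fun τ => by
    simpa using (hasDerivAt_id τ).const_mul t
  have hu : ∀ τ ∈ Icc (0 : ℝ) 1, HasDerivAt (fun τ => fderiv ℝ (G (t * τ)) x w)
      ((t • fderiv ℝ f (G (t * τ) x)) (fderiv ℝ (G (t * τ)) x w)) τ := fun τ hτ =>
    (h.hasDerivAt_fderiv (mul_mem ht hτ) hx w).scomp τ (hscale τ)
  have hv : ∀ τ ∈ Icc (0 : ℝ) 1, HasDerivAt (fun τ => ∑ i, ν (t * τ) i • Y i (G (t * τ) x))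
      ((t • fderiv ℝ f (G (t * τ) x)) (∑ i, ν (t * τ) i • Y i (G (t * τ) x))) τ := by
    intro τ hτ
    have hr := mul_mem ht hτ
    set r := t * τ
    have h1 : HasDerivAt (fun r => ∑ i, ν r i • Y i (G r x))
        (fderiv ℝ f (G r x) (∑ i, ν r i • Y i (G r x))) r := by
      have h2 : HasDerivAt (fun r => ∑ i, ν r i • Y i (G r x))
          (∑ i, (ν r i • fderiv ℝ (Y i) (G r x) (f (G r x)) +
            (-∑ k, b r i k * ν r k) • Y i (G r x))) r :=
        HasDerivAt.fun_sum fun i _ => (hν r hr (hle τ hτ) i).smul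
          ((hY i (G r x)).hasFDerivAt.comp_hasDerivAt r (h.hasDerivAt x hx r hr))
      refine h2.congr_deriv ?_
      -- DY_i f = [f, Y_i] + Df Y_i. The bracket terms cancel against ν' = -bν, leaving Df applied
      -- to the combination.
      have h3 : ∀ i, fderiv ℝ (Y i) (G r x) (f (G r x)) =
          (∑ k, b r k i • Y k (G r x)) + fderiv ℝ f (G r x) (Y i (G r x)) := fun i => by
        rw [← hb r hr (hle τ hτ) i, VectorField.lieBracket]; abel
      have h4 : ∑ i, (∑ k, b r i k * ν r k) • Y i (G r x) =
          ∑ i, ν r i • ∑ k, b r k i • Y k (G r x) := by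
        simp only [Finset.sum_smul, Finset.smul_sum, smul_smul]
        rw [Finset.sum_comm]
        simp only [mul_comm]
      simp only [h3, smul_add, neg_smul, Finset.sum_add_distrib, Finset.sum_neg_distrib, h4,
        map_sum, map_smul]
      abel
    exact h1.scomp τ (hscale τ)
  have hL : ContinuousOn (fun τ => t • fderiv ℝ f (G (t * τ) x)) (Icc (0 : ℝ) 1) :=
    fun τ hτ => (((h.field.continuous_fderiv (by simp)).continuousAt.comp
      (f := fun τ => G (t * τ) x) (h.hasDerivAt_mul ht hx hτ).continuousAt).const_smul
        t).continuousWithinAt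
  have hid : fderiv ℝ (G 0) x = ContinuousLinearMap.id ℝ E := by
    refine ((hasFDerivAt_id x).congr_of_eventuallyEq ?_).fderiv
    filter_upwards [isOpen_ball.mem_nhds hx] with z hz
    exact h.initial z hz
  have := eqOn_unitInterval_of_linear hL hu hv (by simp [hid, h.initial x hx, w])
    (right_mem_Icc.2 zero_le_one)
  simpa using this

end IsSmoothFlowOn

theorem exists_isSmoothFlowOn [FiniteDimensional ℝ E] {f : E → E} (hf : ContDiff ℝ ∞ f)
    {a : ℝ} (ha : 0 < a) {V : Set E} (hV : IsOpen V) {x₀ : E} (hx₀ : x₀ ∈ V) {G : ℝ → E → E}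
    (h0 : ∀ x ∈ V, G 0 x = x)
    (hG : ∀ x ∈ V, ∀ t ∈ Ioo (-a) a, HasDerivAt (fun s => G s x) (f (G t x)) t) :
    ∃ ρ > 0, IsSmoothFlowOn f x₀ ρ G := by
  obtain ⟨ε, hε, hεa, hεV, hs⟩ := exists_contDiffOn_localFlow hf ha hV hx₀ h0 hG
  refine ⟨ε, hε, hf, fun x hx => h0 x (hεV hx), fun x hx t ht => hG x (hεV hx) t ?_, hs⟩
  rw [mem_ball_zero_iff, Real.norm_eq_abs, abs_lt] at ht
  exact ⟨by linarith [ht.1], by linarith [ht.2]⟩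

theorem exists_smoothFlow [FiniteDimensional ℝ E] {f : E → E} (hf : ContDiff ℝ ∞ f) (x₀ : E) :
    ∃ ρ > 0, ∃ G, IsSmoothFlowOn f x₀ ρ G := by
  have : CompleteSpace E := FiniteDimensional.complete ℝ E
  obtain ⟨r, hr, ε, hε, h⟩ := (hf.contDiffAt (x := x₀).of_le
    (by simp : (1 : WithTop ℕ∞) ≤ ∞)).exists_forall_mem_closedBall_exists_eq_forall_mem_Ioo_hasDerivAt 0
  have h' : ∀ x, ∃ γ : ℝ → E, x ∈ closedBall x₀ r →
      γ 0 = x ∧ ∀ t ∈ Ioo (0 - ε) (0 + ε), HasDerivAt γ (f (γ t)) t := fun x => by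
    by_cases hx : x ∈ closedBall x₀ r
    · exact (h x hx).imp fun γ hγ _ => hγ
    -- Outside the ball the curve is a dummy; nothing is claimed there.
    · exact ⟨0, fun hx' => absurd hx' hx⟩
  choose γ hγ using h'
  obtain ⟨ρ, hρ, hG⟩ := exists_isSmoothFlowOn hf hε isOpen_ball (mem_ball_self hr)
    (G := fun t x => γ x t) (fun x hx => (hγ x (ball_subset_closedBall hx)).1)
    (fun x hx t ht => (hγ x (ball_subset_closedBall hx)).2 t (by simpa using ht))
  exact ⟨ρ, hρ, _, hG⟩

end SmoothFlow

/-! ### Smooth dependence on parameters and smooth extension -/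

section Parameters

variable {M : ℕ} {E : Type u} [NormedAddCommGroup E] [NormedSpace ℝ E]

/-- The norm is the sup norm, so the ball is a cube and coordinates can be changed independently. -/
theorem update_mem_ball {p : Fin M → ℝ} {α : ℝ} (hp : p ∈ ball (0 : Fin M → ℝ) α) (j : Fin M)
    {s : ℝ} (hs : |s| < α) : Function.update p j s ∈ ball (0 : Fin M → ℝ) α := by
  have hα := pos_of_mem_ball hp
  rw [mem_ball_zero_iff, pi_norm_lt_iff hα] at hp ⊢
  intro i
  by_cases h : i = j
  · subst h; simpa using hs
  · simpa [h] using hp i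

theorem abs_apply_lt {p : Fin M → ℝ} {α : ℝ} (hp : p ∈ ball (0 : Fin M → ℝ) α) (j : Fin M) :
    |p j| < α :=
  (norm_le_pi_norm p j).trans_lt (mem_ball_zero_iff.1 hp)

/-- Local solutions of `∂S/∂pⱼ = f(p, S)`, `S = S₀` for `pⱼ = 0`, depend smoothly on `p`. -/
theorem exists_smooth_solution [FiniteDimensional ℝ E] (j : Fin M) {f : (Fin M → ℝ) × E → E}
    (hf : ContDiff ℝ ∞ f) (S₀ : E) :
    ∃ ε > 0, ∃ S : (Fin M → ℝ) → E, ContDiffOn ℝ ∞ S (ball 0 ε) ∧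
      (∀ p ∈ ball (0 : Fin M → ℝ) ε, p j = 0 → S p = S₀) ∧
      ∀ p ∈ ball (0 : Fin M → ℝ) ε,
        HasDerivAt (fun s => S (Function.update p j s)) (f (p, S p)) (p j) := by
  -- The parameter joins the state: along the field (e_j, f), the coordinate p_j runs as time.
  have hF : ContDiff ℝ ∞ fun q : (Fin M → ℝ) × E => ((Pi.single j 1 : Fin M → ℝ), f q) :=
    contDiff_const.prodMk hf
  obtain ⟨ε, hε, G, hG⟩ := exists_smoothFlow hF ((0 : Fin M → ℝ), S₀)
  have hmem : ∀ p ∈ ball (0 : Fin M → ℝ) ε, (Function.update p j 0, S₀) ∈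
      ball ((0 : Fin M → ℝ), S₀) ε := fun p hp => by
    rw [← ball_prod_same]
    exact ⟨update_mem_ball hp j (by simpa using hε), mem_ball_self hε⟩
  have hfst : ∀ p ∈ ball (0 : Fin M → ℝ) ε, ∀ s ∈ ball (0 : ℝ) ε,
      (G s (Function.update p j 0, S₀)).1 = Function.update p j s := by
    intro p hp s hs
    have hd : ∀ r ∈ ball (0 : ℝ) ε, HasDerivAt
        (fun r => (G r (Function.update p j 0, S₀)).1 - Function.update p j r) 0 r := by
      intro r hr
      have h1 := (hasFDerivAt_fst.comp_hasDerivAt r (hG.hasDerivAt _ (hmem p hp) r hr)).sub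
        (hasDerivAt_update p j r)
      exact h1.congr_deriv (sub_self _)
    have h0 := isOpen_ball.is_const_of_deriv_eq_zero (convex_ball (0 : ℝ) ε).isPreconnected
      (fun r hr => (hd r hr).differentiableAt.differentiableWithinAt)
      (fun r hr => (hd r hr).deriv) hs (mem_ball_self hε)
    simpa [hG.initial _ (hmem p hp), sub_eq_zero] using h0
  -- Start from `p` with its `j`-th coordinate set to 0 and flow for time `p j`.
  refine ⟨ε, hε, fun p => (G (p j) (Function.update p j 0, S₀)).2, ?_, ?_, ?_⟩
  · have h1 : ContDiff ℝ ∞ fun p : Fin M → ℝ => (p j, (Function.update p j 0, S₀)) := by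
      refine (contDiff_apply ℝ ℝ j).prodMk (ContDiff.prodMk (contDiff_pi.2 fun i => ?_)
        contDiff_const)
      by_cases h : i = j
      · subst h; simpa using contDiff_const
      · simpa [h] using contDiff_apply ℝ ℝ i
    exact contDiff_snd.comp_contDiffOn (hG.contDiffOn.comp h1.contDiffOn fun p hp =>
      ⟨by simpa using abs_apply_lt hp j, hmem p hp⟩)
  · intro p hp hj
    simp only [hj, hG.initial _ (hmem p hp)]
  · intro p hp
    have hs : p j ∈ ball (0 : ℝ) ε := by simpa using abs_apply_lt hp j
    have h1 := hasFDerivAt_snd.comp_hasDerivAt (p j) (hG.hasDerivAt _ (hmem p hp) _ hs)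
    have h2 := hfst p hp _ hs
    rw [Function.update_eq_self] at h2
    simp only [Function.update_self, Function.update_idem]
    refine h1.congr_deriv ?_
    exact congrArg f (Prod.ext h2 rfl)

/-- Generator coefficients are smooth only on the box, whereas `exists_smooth_solution` takes
globally smooth data. A bump function bridges the gap. -/
theorem exists_contDiff_eqOn_ball {f : (Fin M → ℝ) → ℝ} {s : Set (Fin M → ℝ)} (hs : IsOpen s)
    (h0 : 0 ∈ s) (hf : ContDiffOn ℝ ∞ f s) :
    ∃ F : (Fin M → ℝ) → ℝ, ContDiff ℝ ∞ F ∧ ∃ ε > 0, EqOn F f (ball 0 ε) := by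
  obtain ⟨R, hR, hRs⟩ := nhds_basis_closedBall.mem_iff.1 (hs.mem_nhds h0)
  let χ : ContDiffBump (0 : Fin M → ℝ) := ⟨R / 2, R, by linarith, by linarith⟩
  refine ⟨fun p => χ p * f p, contDiff_iff_contDiffAt.2 fun p => ?_, R / 2, by linarith,
    fun p hp => ?_⟩
  · by_cases hp : p ∈ s
    · exact χ.contDiff.contDiffAt.mul (hf.contDiffAt (hs.mem_nhds hp))
    · have : p ∈ (closedBall (0 : Fin M → ℝ) R)ᶜ := fun h => hp (hRs h)
      refine contDiffAt_const (c := (0 : ℝ)) |>.congr_of_eventuallyEq ?_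
      filter_upwards [isClosed_closedBall.isOpen_compl.mem_nhds this] with q hq
      rw [χ.zero_of_le_dist (le_of_not_ge fun h => hq (mem_closedBall.2 h)), zero_mul]
  · simp only [χ.one_of_mem_closedBall (ball_subset_closedBall hp), one_mul]

end Parameters

/-! ### Orbit tails and bracket coefficients along them -/

section Orbits

variable {n k : ℕ} {G : Fin k → ℝ → RVec n → RVec n} {x₀ : RVec n}

theorem orbitTail_of_le (p : Fin k → ℝ) {j : ℕ} (hj : k ≤ j) : orbitTail G x₀ p j = x₀ := by
  rw [orbitTail, List.drop_eq_nil_of_le (by simpa using hj), List.foldr_nil]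

theorem orbitTail_eq (p : Fin k → ℝ) (j : Fin k) :
    orbitTail G x₀ p j = G j (p j) (orbitTail G x₀ p (j + 1)) := by
  rw [orbitTail, List.drop_eq_getElem_cons (by simp), List.foldr_cons]
  simp [orbitTail]

/-- Downward induction for statements that are clear from index `k` on. -/
theorem downward_induction {P : ℕ → Prop} (hbase : ∀ j, k ≤ j → P j)
    (hstep : ∀ j : Fin k, P (j + 1) → P j) (j : ℕ) : P j := by
  induction h : k - j generalizing j with
  | zero => exact hbase j (by omega)
  | succ d ih => exact hstep ⟨j, by omega⟩ (ih (j + 1) (by omega))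

theorem orbitTail_congr {p q : Fin k → ℝ} (j : ℕ) :
    (∀ i : Fin k, j ≤ i → p i = q i) → orbitTail G x₀ p j = orbitTail G x₀ q j := by
  refine downward_induction (k := k) (P := fun j => (∀ i : Fin k, j ≤ i → p i = q i) →
    orbitTail G x₀ p j = orbitTail G x₀ q j) (fun j hj _ => ?_) (fun j ih h => ?_) j
  · rw [orbitTail_of_le p hj, orbitTail_of_le q hj]
  · rw [orbitTail_eq, orbitTail_eq, h j le_rfl, ih fun i hi => h i (by omega)]

theorem orbitTail_update (p : Fin k → ℝ) (i : Fin k) (r : ℝ) :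
    orbitTail G x₀ (Function.update p i r) i = G i r (orbitTail G x₀ p (i + 1)) := by
  rw [orbitTail_eq, Function.update_self]
  congr 1
  refine orbitTail_congr _ fun l hl => ?_
  rw [Function.update_of_ne]
  rintro rfl
  omega

/-- For `i = 0` this exhibits a tail as a full orbit, the only kind of curve that finite generation
speaks about. -/
theorem orbitTail_freeze (j : Fin k) (p : Fin k → ℝ) (i : ℕ) :
    orbitTail (fun i => if i < j then fun _ x => x else G i) x₀ p i =
      orbitTail G x₀ p (max i j) := by
  refine downward_induction (k := k) (P := fun i => orbitTail (fun i => if i < j then fun _ x => x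
    else G i) x₀ p i = orbitTail G x₀ p (max i j)) (fun i hi => ?_) (fun i ih => ?_) i
  · rw [orbitTail_of_le p hi, orbitTail_of_le p (hi.trans (le_max_left _ _))]
  · rw [orbitTail_eq, ih]
    by_cases h : i < j
    · have h1 : (i : ℕ) < j := h
      rw [max_eq_right h1.le, max_eq_right (Nat.succ_le_of_lt h1)]
      simp [h]
    · have h' : (j : ℕ) ≤ i := not_lt.1 h
      rw [max_eq_left h', max_eq_left (by omega), orbitTail_eq p i]
      simp [h]

theorem isOpen_openBox (a : Fin k → ℝ) : IsOpen (openBox a) :=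
  isOpen_set_pi finite_univ fun _ _ => isOpen_Ioo

theorem zero_mem_openBox {a : Fin k → ℝ} (ha : ∀ i, 0 < a i) : 0 ∈ openBox a :=
  fun i _ => ⟨neg_neg_of_pos (ha i), ha i⟩

/-- Every field of `L` is a smooth combination of the generators along the tails of an orbit along
the generators: replace the flows that do not enter the tail by the flow of the zero field. -/
theorem IsGeneratorSystem.exists_tail {M : ℕ} {L : Submodule ℝ (RVec n → RVec n)}
    {Y : Fin M → RVec n → RVec n} (hY : IsGeneratorSystem L x₀ Y) {a : Fin M → ℝ}
    {V : Set (RVec n)} {G : Fin M → ℝ → RVec n → RVec n} (hG : IsOrbit Y x₀ a V G) (j : Fin M)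
    {W : RVec n → RVec n} (hW : W ∈ L) :
    ∃ c : Fin M → (Fin M → ℝ) → ℝ, (∀ i, ContDiffOn ℝ ∞ (c i) (openBox a)) ∧
      ∀ p ∈ openBox a,
        W (orbitTail G x₀ p j) = ∑ i, c i p • Y i (orbitTail G x₀ p j) := by
  have h0 : IsOrbit (fun i => if i < j then 0 else Y i) x₀ a V
      (fun i => if i < j then fun _ x => x else G i) := by
    refine ⟨hG.pos, hG.isOpen, hG.mem, fun i => ?_, fun p hp i => ?_⟩
    · by_cases h : i < j
      · simp only [h, if_true]
        exact ⟨fun _ _ => rfl, fun x _ t _ => hasDerivAt_const t x⟩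
      · simp only [h, if_false]
        exact hG.flow i
    · rw [orbitTail_freeze]
      by_cases h : (i : ℕ) + 1 ≤ j
      · rw [max_eq_right h]
        have := hG.tail_mem p hp ⟨j - 1, by omega⟩
        simpa [Nat.sub_add_cancel (show 1 ≤ (j : ℕ) by omega)] using this
      · rw [max_eq_left (by omega)]
        exact hG.tail_mem p hp i
  obtain ⟨c, hc, hc'⟩ := hY.2 M _ a V _ (fun i => by
    by_cases h : i < j
    · simp [h]
    · simpa [h] using hY.1 i) h0 W hW
  refine ⟨c, hc, fun p hp => ?_⟩
  have := hc' p hp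
  rwa [orbit, orbitTail_freeze, max_eq_right (Nat.zero_le _)] at this

theorem exists_pos_forall_le {ι : Type*} [Finite ι] (ε : ι → ℝ) (h : ∀ i, 0 < ε i) :
    ∃ δ > 0, ∀ i, δ ≤ ε i := by
  cases nonempty_fintype ι
  cases isEmpty_or_nonempty ι
  · exact ⟨1, one_pos, fun i => isEmptyElim i⟩
  · obtain ⟨i, hi⟩ := Finite.exists_min ε
    exact ⟨ε i, h i, hi⟩

/-- The structure matrices of the brackets `[Y j, Y l]` along the tails of an orbit. -/
theorem exists_bracket_coefficients {M : ℕ} {L : Submodule ℝ (RVec n → RVec n)}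
    (hL : IsLieAlgebraOfFields L) {Y : Fin M → RVec n → RVec n} (hY : IsGeneratorSystem L x₀ Y)
    {a : Fin M → ℝ} {V : Set (RVec n)} {G : Fin M → ℝ → RVec n → RVec n}
    (hG : IsOrbit Y x₀ a V G) :
    ∃ B : Fin M → (Fin M → ℝ) → Matrix (Fin M) (Fin M) ℝ,
      (∀ j i l, ContDiff ℝ ∞ fun p => B j p i l) ∧
      (∀ j p q, (∀ i, j ≤ i → p i = q i) → B j p = B j q) ∧
      ∃ ε > 0, ∀ j l, ∀ p ∈ ball (0 : Fin M → ℝ) ε,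
        VectorField.lieBracket ℝ (Y j) (Y l) (orbitTail G x₀ p j) =
          ∑ i, B j p i l • Y i (orbitTail G x₀ p j) := by
  choose c hc hc' using fun j l => hY.exists_tail hG j (hL.2 _ (hY.1 j) _ (hY.1 l))
  choose F hF ε hε hF' using fun j l i => exists_contDiff_eqOn_ball (isOpen_openBox a)
    (zero_mem_openBox hG.pos) (hc j l i)
  obtain ⟨δ, hδ, hδ'⟩ := exists_pos_forall_le
    (fun t : Fin M × Fin M × Fin M => ε t.1 t.2.1 t.2.2) fun t => hε _ _ _
  obtain ⟨R, hR, hRa⟩ := nhds_basis_ball.mem_iff.1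
    ((isOpen_openBox a).mem_nhds (zero_mem_openBox hG.pos))
  -- Evaluating the coefficients at `π j p` makes B_j depend on t_j, t_{j+1}, … only; the tail from
  -- `j` does not see the zeroed coordinates.
  let π : Fin M → (Fin M → ℝ) → Fin M → ℝ := fun j p i => if i < j then 0 else p i
  have hπ : ∀ j, ContDiff ℝ ∞ (π j) := fun j => contDiff_pi.2 fun i => by
    by_cases h : i < j
    · simpa [π, h] using contDiff_const
    · simpa [π, h] using contDiff_apply ℝ ℝ i
  refine ⟨fun j p => Matrix.of fun i l => F j l i (π j p), fun j i l => (hF j l i).comp (hπ j),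
    fun j p q h => ?_, min δ R, lt_min hδ hR, fun j l p hp => ?_⟩
  · have : π j p = π j q := funext fun i => by
      by_cases hi : i < j
      · simp [π, hi]
      · simp [π, hi, h i (not_lt.1 hi)]
    simp [this]
  · have hpos : 0 < min δ R := lt_min hδ hR
    have hq : π j p ∈ ball (0 : Fin M → ℝ) (min δ R) := by
      rw [mem_ball_zero_iff, pi_norm_lt_iff hpos] at hp ⊢
      intro i
      by_cases hi : i < j
      · simpa [π, hi] using hpos
      · simpa [π, hi] using hp i
    have htail : orbitTail G x₀ p j = orbitTail G x₀ (π j p) j :=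
      orbitTail_congr _ fun i hi => by simp [π, not_lt.2 (show j ≤ i from hi)]
    rw [htail, hc' j l _ (hRa (ball_subset_ball (min_le_right _ _) hq))]
    refine Finset.sum_congr rfl fun i _ => ?_
    rw [← hF' j l i (ball_subset_ball ((min_le_left _ _).trans (hδ' (j, l, i))) hq)]
    rfl

end Orbits

/-! ### The matrices N_j and their inverses K_j -/

section MatrixEquations

variable {M : ℕ}

theorem contDiffOn_listProd {X : Type*} [NormedAddCommGroup X] [NormedSpace ℝ X] {s : Set X}
    {ι : Type*} {N : ι → X → Matrix (Fin M) (Fin M) ℝ}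
    (hN : ∀ t i l, ContDiffOn ℝ ∞ (fun p => N t p i l) s) (L : List ι) (i l : Fin M) :
    ContDiffOn ℝ ∞ (fun p => (L.map fun t => N t p).prod i l) s := by
  induction L generalizing i l with
  | nil => simpa using contDiffOn_const
  | cons t L ih =>
    simp only [List.map_cons, List.prod_cons, Matrix.mul_apply]
    exact ContDiffOn.sum fun k _ => (hN t i k).mul (ih k l)

theorem exists_matrix_solutions (j : Fin M) {B : (Fin M → ℝ) → Matrix (Fin M) (Fin M) ℝ}
    (hB : ∀ i l, ContDiff ℝ ∞ fun p => B p i l) :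
    ∃ ε > 0, ∃ N K : (Fin M → ℝ) → Matrix (Fin M) (Fin M) ℝ,
      (∀ i l, ContDiffOn ℝ ∞ (fun p => N p i l) (ball 0 ε)) ∧
      (∀ p ∈ ball (0 : Fin M → ℝ) ε, p j = 0 → N p = 1) ∧
      (∀ p ∈ ball (0 : Fin M → ℝ) ε, p j = 0 → K p = 1) ∧
      (∀ p ∈ ball (0 : Fin M → ℝ) ε, ∀ i l,
        HasDerivAt (fun s => N (Function.update p j s) i l) (-(B p * N p) i l) (p j)) ∧
      (∀ p ∈ ball (0 : Fin M → ℝ) ε, ∀ i l,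
        HasDerivAt (fun s => K (Function.update p j s) i l) ((K p * B p) i l) (p j)) ∧
      ∀ p ∈ ball (0 : Fin M → ℝ) ε, N p * K p = 1 := by
  have hS : ∀ k l, ContDiff ℝ ∞ fun q : (Fin M → ℝ) × (Fin M → Fin M → ℝ) => q.2 k l :=
    fun k l => (contDiff_apply_apply ℝ ℝ k l).comp contDiff_snd
  obtain ⟨ε₁, hε₁, N, hN, hN1, hN'⟩ := exists_smooth_solution j
    (f := fun q : (Fin M → ℝ) × (Fin M → Fin M → ℝ) => fun i l => -∑ k, B q.1 i k * q.2 k l)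
    (contDiff_pi.2 fun i => contDiff_pi.2 fun l => ContDiff.neg <| ContDiff.sum fun k _ =>
      ((hB i k).comp contDiff_fst).mul (hS k l)) (1 : Matrix (Fin M) (Fin M) ℝ)
  obtain ⟨ε₂, hε₂, K, hK, hK1, hK'⟩ := exists_smooth_solution j
    (f := fun q : (Fin M → ℝ) × (Fin M → Fin M → ℝ) => fun i l => ∑ k, q.2 i k * B q.1 k l)
    (contDiff_pi.2 fun i => contDiff_pi.2 fun l => ContDiff.sum fun k _ =>
      (hS i k).mul ((hB k l).comp contDiff_fst)) (1 : Matrix (Fin M) (Fin M) ℝ)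
  have h1 : ball (0 : Fin M → ℝ) (min ε₁ ε₂) ⊆ ball 0 ε₁ := ball_subset_ball (min_le_left _ _)
  have h2 : ball (0 : Fin M → ℝ) (min ε₁ ε₂) ⊆ ball 0 ε₂ := ball_subset_ball (min_le_right _ _)
  have hε : 0 < min ε₁ ε₂ := lt_min hε₁ hε₂
  have dN : ∀ p ∈ ball (0 : Fin M → ℝ) (min ε₁ ε₂), ∀ i l,
      HasDerivAt (fun s => N (Function.update p j s) i l) (-∑ k, B p i k * N p k l) (p j) :=
    fun p hp i l => hasDerivAt_pi.1 (hasDerivAt_pi.1 (hN' p (h1 hp)) i) l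
  have dK : ∀ p ∈ ball (0 : Fin M → ℝ) (min ε₁ ε₂), ∀ i l,
      HasDerivAt (fun s => K (Function.update p j s) i l) (∑ k, K p i k * B p k l) (p j) :=
    fun p hp i l => hasDerivAt_pi.1 (hasDerivAt_pi.1 (hK' p (h2 hp)) i) l
  refine ⟨min ε₁ ε₂, hε, fun p => Matrix.of (N p), fun p => Matrix.of (K p),
    fun i l => ((contDiff_apply_apply ℝ ℝ i l).comp_contDiffOn hN).mono h1,
    fun p hp h => hN1 p (h1 hp) h, fun p hp h => hK1 p (h2 hp) h,
    fun p hp i l => by simpa [Matrix.mul_apply] using dN p hp i l,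
    fun p hp i l => by simpa [Matrix.mul_apply] using dK p hp i l, fun p hp => ?_⟩
  -- The product K N is the convenient order: its derivative is (KB)N - K(BN) = 0.
  rw [mul_eq_one_comm]
  ext i l
  have hd : ∀ r ∈ ball (0 : ℝ) (min ε₁ ε₂), HasDerivAt (fun r =>
      ∑ k, K (Function.update p j r) i k * N (Function.update p j r) k l) 0 r := by
    intro r hr
    have hr' : |r| < min ε₁ ε₂ := by simpa using hr
    have hq := update_mem_ball hp j hr'
    have := HasDerivAt.fun_sum (u := Finset.univ) fun k _ => (dK _ hq i k).mul (dN _ hq k l)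
    simp only [Function.update_idem, Function.update_self] at this
    refine this.congr_deriv ?_
    rw [Finset.sum_add_distrib]
    simp only [mul_neg, Finset.sum_neg_distrib, Finset.sum_mul, Finset.mul_sum]
    rw [Finset.sum_comm, ← sub_eq_add_neg, sub_eq_zero]
    simp only [mul_assoc]
  have hpj : p j ∈ ball (0 : ℝ) (min ε₁ ε₂) := by simpa using abs_apply_lt hp j
  have hconst := isOpen_ball.is_const_of_deriv_eq_zero
    (convex_ball (0 : ℝ) (min ε₁ ε₂)).isPreconnected
    (fun r hr => (hd r hr).differentiableAt.differentiableWithinAt)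
    (fun r hr => (hd r hr).deriv) hpj (mem_ball_self hε)
  have hq0 := update_mem_ball hp j (s := 0) (by simpa using hε)
  rw [Function.update_eq_self, hN1 _ (h1 hq0) (by simp), hK1 _ (h2 hq0) (by simp),
    ← Matrix.mul_apply (M := (1 : Matrix (Fin M) (Fin M) ℝ)), mul_one] at hconst
  rw [Matrix.mul_apply]
  exact hconst

end MatrixEquations

/-! ### The gradient system along the orbit -/

section GradientSystem

variable {n M : ℕ} {x₀ : RVec n} {Y : Fin M → RVec n → RVec n} {a : Fin M → ℝ} {V : Set (RVec n)}
  {G : Fin M → ℝ → RVec n → RVec n}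

theorem orbitTail_zero (hG : IsOrbit Y x₀ a V G) (j : ℕ) : orbitTail G x₀ 0 j = x₀ := by
  refine downward_induction (k := M) (P := fun j => orbitTail G x₀ 0 j = x₀)
    (fun j hj => orbitTail_of_le 0 hj) (fun j ih => ?_) j
  rw [orbitTail_eq, ih, Pi.zero_apply, (hG.flow j).initial _ hG.mem]

theorem tendsto_orbitTail (hG : IsOrbit Y x₀ a V G) {ρ : ℝ} (hρ : 0 < ρ)
    (hflow : ∀ i, IsSmoothFlowOn (Y i) x₀ ρ (G i)) (j : ℕ) :
    Tendsto (fun p => orbitTail G x₀ p j) (𝓝 0) (𝓝 x₀) := by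
  refine downward_induction (k := M) (P := fun j => Tendsto (fun p => orbitTail G x₀ p j) (𝓝 0)
    (𝓝 x₀)) (fun j hj => ?_) (fun j ih => ?_) j
  · simp only [orbitTail_of_le _ hj]
    exact tendsto_const_nhds
  · simp only [orbitTail_eq]
    have h1 := ((hflow j).contDiffAt (mem_ball_self hρ) (mem_ball_self hρ)).continuousAt
    have h2 : Tendsto (fun p : Fin M → ℝ => (p j, orbitTail G x₀ p (j + 1))) (𝓝 0)
        (𝓝 ((0 : ℝ), x₀)) :=
      ((continuous_apply j).tendsto (0 : Fin M → ℝ)).prodMk_nhds ih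
    have h3 := h1.tendsto.comp h2
    rwa [(hG.flow j).initial _ hG.mem] at h3

theorem drop_take_finRange {i j : Fin M} (h : i < j) :
    ((List.finRange M).take j).drop i = i :: ((List.finRange M).take j).drop (i + 1) := by
  rw [List.drop_eq_getElem_cons (by simpa using h)]
  simp

theorem pullBack_cons_orbitTail {ρ : ℝ} {i : Fin M} (hflow : IsSmoothFlowOn (Y i) x₀ ρ (G i))
    {p : Fin M → ℝ} (hp : p i ∈ ball (0 : ℝ) ρ) (hi : orbitTail G x₀ p i ∈ ball x₀ ρ)
    (hi' : orbitTail G x₀ p (i + 1) ∈ ball x₀ ρ) (W : RVec n → RVec n) (l : List (Fin M)) :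
    pullBack G p W (i :: l) (orbitTail G x₀ p i) =
      fderiv ℝ (G i (p i)) (orbitTail G x₀ p (i + 1))
        (pullBack G p W l (orbitTail G x₀ p (i + 1))) := by
  rw [orbitTail_eq] at hi ⊢
  rw [pullBack, hflow.inverse_fderiv_neg hp hi' hi, hflow.neg_apply_apply hp hi' hi]

/-- Induction on `d = j - i`: at `d = 0` this is the flow equation, and each earlier flow
contributes its Jacobian by the chain rule. -/
theorem hasDerivAt_orbitTail {ρ : ℝ} (hflow : ∀ i, IsSmoothFlowOn (Y i) x₀ ρ (G i))
    {p : Fin M → ℝ} (hp : ∀ i, p i ∈ ball (0 : ℝ) ρ) (hmem : ∀ i, orbitTail G x₀ p i ∈ ball x₀ ρ)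
    (j : Fin M) (d : ℕ) : ∀ i, i + d = j →
      HasDerivAt (fun s => orbitTail G x₀ (Function.update p j s) i)
        (pullBack G p (Y j) (((List.finRange M).take j).drop i) (orbitTail G x₀ p i)) (p j) := by
  induction d with
  | zero =>
    rintro i hi
    obtain rfl : i = j := by omega
    simp only [orbitTail_update]
    rw [List.drop_eq_nil_of_le (by simp), pullBack, orbitTail_eq]
    exact (hflow j).hasDerivAt _ (hmem _) _ (hp j)
  | succ d ih =>
    intro i hi
    have hij : i < (j : ℕ) := by omega
    obtain ⟨i, rfl⟩ : ∃ i' : Fin M, (i' : ℕ) = i := ⟨⟨i, by omega⟩, rfl⟩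
    rw [drop_take_finRange hij, pullBack_cons_orbitTail (hflow i) (hp i) (hmem i) (hmem _)]
    have h1 := ih (i + 1) (by omega)
    have h2 := ((hflow i).differentiableAt (hp i) (hmem (i + 1))).hasFDerivAt
    have h3 : HasFDerivAt (G i (p i)) (fderiv ℝ (G i (p i)) (orbitTail G x₀ p (i + 1)))
        (orbitTail G x₀ (Function.update p j (p j)) (i + 1)) := by
      rwa [Function.update_eq_self]
    refine (h3.comp_hasDerivAt (p j) h1).congr_of_eventuallyEq (Eventually.of_forall fun s => ?_)
    have hne : i ≠ j := fun h => by simp [h] at hij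
    simp [orbitTail_eq _ i, hne]

theorem pullBack_eq_sum {ρ : ℝ} (hflow : ∀ i, IsSmoothFlowOn (Y i) x₀ ρ (G i)) {ε : ℝ}
    {B N : Fin M → (Fin M → ℝ) → Matrix (Fin M) (Fin M) ℝ}
    (hB : ∀ j l, ∀ p ∈ ball (0 : Fin M → ℝ) ε,
      VectorField.lieBracket ℝ (Y j) (Y l) (orbitTail G x₀ p j) =
        ∑ i, B j p i l • Y i (orbitTail G x₀ p j))
    (hN1 : ∀ j, ∀ p ∈ ball (0 : Fin M → ℝ) ε, p j = 0 → N j p = 1)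
    (hN : ∀ j, ∀ p ∈ ball (0 : Fin M → ℝ) ε, ∀ i l,
      HasDerivAt (fun s => N j (Function.update p j s) i l) (-(B j p * N j p) i l) (p j))
    {p : Fin M → ℝ} (hpε : p ∈ ball (0 : Fin M → ℝ) ε) (hp : ∀ i, p i ∈ ball (0 : ℝ) ρ)
    (hmem : ∀ i, orbitTail G x₀ p i ∈ ball x₀ ρ) (j : Fin M) (d : ℕ) : ∀ i, i + d = j →
      pullBack G p (Y j) (((List.finRange M).take j).drop i) (orbitTail G x₀ p i) =
        ∑ m, ((((List.finRange M).take j).drop i).map fun l => N l p).prod m j •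
          Y m (orbitTail G x₀ p i) := by
  induction d with
  | zero =>
    rintro i hi
    obtain rfl : i = j := by omega
    rw [List.drop_eq_nil_of_le (by simp), pullBack]
    simp [Matrix.one_apply]
  | succ d ih =>
    intro i hi
    have hij : i < (j : ℕ) := by omega
    obtain ⟨i, rfl⟩ : ∃ i' : Fin M, (i' : ℕ) = i := ⟨⟨i, by omega⟩, rfl⟩
    rw [drop_take_finRange hij, pullBack_cons_orbitTail (hflow i) (hp i) (hmem i) (hmem _),
      ih (i + 1) (by omega), List.map_cons, List.prod_cons]
    set P := ((((List.finRange M).take j).drop (i + 1)).map fun l => N l p).prod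
    have hε := pos_of_mem_ball hpε
    have hup : ∀ r : ℝ, |r| ≤ |p i| → Function.update p i r ∈ ball (0 : Fin M → ℝ) ε :=
      fun r hr => update_mem_ball hpε i (hr.trans_lt (abs_apply_lt hpε i))
    -- The coefficient curve is column `j` of N_i(p with t_i = r) P, where `P` is frozen at `p`: it
    -- starts at column `j` of `P` and satisfies ν' = -B_i ν.
    have key := (hflow i).fderiv_apply_sum (Y := Y)
      (fun l => (hflow l).field.differentiable (by simp)) (hp i) (hmem (i + 1))
      (b := fun r => B i (Function.update p i r))
      (ν := fun r m => (N i (Function.update p i r) * P) m j)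
      (fun r _ hr l => by
        rw [← orbitTail_update (G := G) (x₀ := x₀)]
        exact hB i l _ (hup r hr))
      (fun r _ hr m => by
        have h1 := HasDerivAt.fun_sum (u := Finset.univ) fun l _ =>
          (hN i _ (hup r hr) m l).mul_const (P l j)
        simp only [Function.update_idem, Function.update_self] at h1
        simp only [← Matrix.mul_apply, ← Matrix.mul_assoc]
        simp only [neg_mul, Finset.sum_neg_distrib, ← Matrix.mul_apply] at h1
        exact h1)
    rw [hN1 i _ (hup 0 (by simp)) (by simp), one_mul, Function.update_eq_self,
      ← orbitTail_eq (G := G) (x₀ := x₀)] at key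
    exact key

end GradientSystem

/-! ### Assembly of the theorem -/

theorem mainTheorem7 {n m M : ℕ} (g : Fin m → RVec n → RVec n) (hg : ∀ i, ContDiff ℝ ∞ (g i))
    (x₀ : RVec n) (Y : Fin M → RVec n → RVec n)
    (hY : IsGeneratorSystem (generatedLieAlgebra g) x₀ Y)
    (a : Fin M → ℝ) (V : Set (RVec n)) (G : Fin M → ℝ → RVec n → RVec n)
    (hG : IsOrbit Y x₀ a V G) :
    ∃ α > 0, Metric.ball (0 : Fin M → ℝ) α ⊆ openBox a ∧
      -- the orbit solves the gradient system, with `y(0) = x₀`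
      orbit G x₀ 0 = x₀ ∧
      (∀ p ∈ Metric.ball (0 : Fin M → ℝ) α, ∀ j,
        HasDerivAt (fun s => orbit G x₀ (Function.update p j s))
          (gradientField Y G j p (orbit G x₀ p)) (p j)) ∧
      ∃ A : (Fin M → ℝ) → Matrix (Fin M) (Fin M) ℝ,
        -- `A` is smooth and nonsingular, `A(0) = I`, and `A` represents the gradient system
        (∀ i j, ContDiffOn ℝ ∞ (fun p => A p i j) (Metric.ball 0 α)) ∧
        (∀ p ∈ Metric.ball (0 : Fin M → ℝ) α, IsUnit (A p)) ∧
        A 0 = 1 ∧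
        (∀ p ∈ Metric.ball (0 : Fin M → ℝ) α, ∀ j,
          gradientField Y G j p (orbit G x₀ p) = ∑ i, A p i j • Y i (orbit G x₀ p)) ∧
        -- `A` is built from the solutions `Z j p` of linear matrix equations
        ∃ (B : Fin M → (Fin M → ℝ) → Matrix (Fin M) (Fin M) ℝ)
          (Z : Fin M → (Fin M → ℝ) → ℝ → Matrix (Fin M) (Fin M) ℝ),
          (∀ j i l, ContDiffOn ℝ ∞ (fun p => B j p i l) (Metric.ball 0 α)) ∧
          (∀ j, ∀ p ∈ Metric.ball (0 : Fin M → ℝ) α, ∀ q ∈ Metric.ball (0 : Fin M → ℝ) α,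
            (∀ i, j ≤ i → p i = q i) → B j p = B j q) ∧
          (∀ j l, ∀ p ∈ Metric.ball (0 : Fin M → ℝ) α,
            VectorField.lieBracket ℝ (Y j) (Y l) (orbitTail G x₀ p j) =
              ∑ i, B j p i l • Y i (orbitTail G x₀ p j)) ∧
          (∀ j, ∀ p ∈ Metric.ball (0 : Fin M → ℝ) α, Z j p 0 = 1 ∧
            ∀ s ∈ Set.uIcc 0 (p j), ∀ i l,
              HasDerivWithinAt (fun r => Z j p r i l)
                (-(Z j p s * B j (Function.update p j (p j - s))) i l) (Set.uIcc 0 (p j)) s) ∧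
          (∀ p ∈ Metric.ball (0 : Fin M → ℝ) α, ∀ i j : Fin M,
            A p i j = orderedProd (fun l => Z l p (p l)) j i j) := by
  have hL := (isLeast_generatedLieAlgebra g hg).1.1
  have hYs : ∀ j, ContDiff ℝ ∞ (Y j) := fun j => hL.1 _ (hY.1 j)
  choose ρ' hρ' hflow' using fun j => exists_isSmoothFlowOn (hYs j) (hG.pos j) hG.isOpen hG.mem
    (hG.flow j).initial (hG.flow j).hasDerivAt
  obtain ⟨ρ, hρ, hρle⟩ := exists_pos_forall_le ρ' hρ'
  have hflow : ∀ i, IsSmoothFlowOn (Y i) x₀ ρ (G i) := fun i => (hflow' i).mono (hρle i)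
  obtain ⟨B, hBs, hBdep, εB, hεB, hB⟩ := exists_bracket_coefficients hL hY hG
  choose ε' hε' N K hNs hN1 hK1 hN hK hNK using fun j => exists_matrix_solutions j (hBs j)
  obtain ⟨ε, hε, hεle⟩ := exists_pos_forall_le ε' hε'
  let A : (Fin M → ℝ) → Matrix (Fin M) (Fin M) ℝ :=
    fun p => Matrix.of fun i j => orderedProd (fun l => N l p) j i j
  have hAs : ∀ i j, ContDiffOn ℝ ∞ (fun p => A p i j) (ball 0 ε) := fun i j =>
    contDiffOn_listProd
      (fun t i l => (hNs t i l).mono (ball_subset_ball (hεle t))) _ i j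
  have hA0 : A 0 = 1 := by
    have h1 : ∀ l, N l 0 = 1 := fun l => hN1 l 0 (mem_ball_self (hε' l)) rfl
    ext i j
    simp [A, orderedProd, h1]
  have hdet : ∀ᶠ p in 𝓝 (0 : Fin M → ℝ), (A p).det ≠ 0 := by
    have hc : ContinuousAt A 0 := continuousAt_pi.2 fun i => continuousAt_pi.2 fun j =>
      (hAs i j).continuousOn.continuousAt (ball_mem_nhds 0 hε)
    have hc' : ContinuousAt (fun p => (A p).det) 0 :=
      (continuous_id.matrix_det.continuousAt (x := A 0)).comp hc
    exact hc'.eventually_ne (by simp [hA0])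
  -- Indices up to `M` suffice, since every later tail is `x₀`; finitely many conditions hold on a
  -- common neighbourhood.
  have htails : ∀ᶠ p in 𝓝 (0 : Fin M → ℝ), ∀ i : Fin (M + 1), orbitTail G x₀ p i ∈ ball x₀ ρ :=
    eventually_all.2 fun i => tendsto_orbitTail hG hρ hflow i (ball_mem_nhds x₀ hρ)
  have hballs : ∀ r > 0, ∀ᶠ p in 𝓝 (0 : Fin M → ℝ), p ∈ ball 0 r := fun r hr => ball_mem_nhds 0 hr
  have hbox : ∀ᶠ p in 𝓝 (0 : Fin M → ℝ), p ∈ openBox a :=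
    (isOpen_openBox a).mem_nhds (zero_mem_openBox hG.pos)
  obtain ⟨α, hα, hsub⟩ := Metric.eventually_nhds_iff_ball.1 ((hdet.and htails).and
    (((hballs ε hε).and (hballs εB hεB)).and ((hballs ρ hρ).and hbox)))
  have hαε : ball (0 : Fin M → ℝ) α ⊆ ball 0 ε := fun p hp => (hsub p hp).2.1.1
  have hαε' : ∀ j, ball (0 : Fin M → ℝ) α ⊆ ball 0 (ε' j) := fun j =>
    hαε.trans (ball_subset_ball (hεle j))
  have hB' : ∀ j l, ∀ p ∈ ball (0 : Fin M → ℝ) α,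
      VectorField.lieBracket ℝ (Y j) (Y l) (orbitTail G x₀ p j) =
        ∑ i, B j p i l • Y i (orbitTail G x₀ p j) :=
    fun j l p hp => hB j l p (hsub p hp).2.1.2
  have hpρ : ∀ p ∈ ball (0 : Fin M → ℝ) α, ∀ i, p i ∈ ball (0 : ℝ) ρ := fun p hp i => by
    simpa using abs_apply_lt (hsub p hp).2.2.1 i
  have hmem : ∀ p ∈ ball (0 : Fin M → ℝ) α, ∀ i, orbitTail G x₀ p i ∈ ball x₀ ρ := by
    intro p hp i
    by_cases hi : i < M + 1
    · exact (hsub p hp).1.2 ⟨i, hi⟩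
    · rw [orbitTail_of_le p (by omega)]
      exact mem_ball_self hρ
  have hK0 : ∀ j, ∀ p ∈ ball (0 : Fin M → ℝ) α, K j (Function.update p j 0) = 1 := fun j p hp =>
    hK1 j _ (hαε' j (update_mem_ball hp j (by simpa using hα))) (by simp)
  -- The witness for Z_j(s) is N_j(p) K_j(p with t_j replaced by t_j - s). It is N_j K_j = 1 at s =
  -- 0 and N_j(p) at s = t_j, where K_j = 1.
  refine ⟨α, hα, fun p hp => (hsub p hp).2.2.2, orbitTail_zero hG 0, fun p hp j => ?_, A,
    fun i j => (hAs i j).mono hαε, fun p hp => ?_, hA0, fun p hp j => ?_, B,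
    fun j p s => N j p * K j (Function.update p j (p j - s)), fun j i l => (hBs j i l).contDiffOn,
    fun j p _ q _ => hBdep j p q, hB', fun j p hp => ⟨?_, fun s hs i l => ?_⟩, fun p hp i j => ?_⟩
  · exact hasDerivAt_orbitTail hflow (hpρ p hp) (hmem p hp) j j 0 (zero_add _)
  · exact (Matrix.isUnit_iff_isUnit_det _).2 (isUnit_iff_ne_zero.2 (hsub p hp).1.1)
  · exact pullBack_eq_sum hflow hB' (fun j p hp => hN1 j p (hαε' j hp))
      (fun j p hp => hN j p (hαε' j hp)) hp (hpρ p hp) (hmem p hp) j j 0 (zero_add _)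
  · simpa using hNK j p (hαε' j hp)
  -- For `s` between 0 and `p j`, of either sign, the shifted parameter stays in the ball, so the
  -- equation for K_j applies.
  · have hs' : |p j - s| ≤ |p j| := by
      rcases le_total 0 (p j) with h | h
      · rw [uIcc_of_le h] at hs
        rw [abs_of_nonneg h, abs_of_nonneg (by linarith [hs.2])]
        linarith [hs.1]
      · rw [uIcc_of_ge h] at hs
        rw [abs_of_nonpos h, abs_of_nonpos (by linarith [hs.1])]
        linarith [hs.2]
    have hq := update_mem_ball hp j (hs'.trans_lt (abs_apply_lt hp j))
    set q := Function.update p j (p j - s) with hqdef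
    have hqj : q j = p j - s := by simp [hqdef]
    have h1 : ∀ k, HasDerivAt (fun r => K j (Function.update p j (p j - r)) k l)
        (-(K j q * B j q) k l) s := fun k => by
      have h2 := hK j q (hαε' j hq) k l
      rw [hqj] at h2
      have h3 := h2.scomp s ((hasDerivAt_id s).const_sub (p j))
      simpa [hqdef, Function.comp_def] using h3
    have h4 := HasDerivAt.fun_sum (u := Finset.univ) fun k _ => (h1 k).const_mul (N j p i k)
    simp only [mul_neg, Finset.sum_neg_distrib, ← Matrix.mul_apply, ← Matrix.mul_assoc] at h4
    exact h4.hasDerivWithinAt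
  · have h1 : ∀ l, N l p * K l (Function.update p l (p l - p l)) = N l p := fun l => by
      rw [sub_self, hK0 l p hp, mul_one]
    simp only [h1, A, Matrix.of_apply]
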